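/- For real $\lambda>-\tfrac12$, $\nu\ge 0$ let $${}^{r}G_\nu^{(\lambda)}(x)={}_2F_1\Big(-\nu,\nu+2\lambda;\lambda+\tfrac12;\tfrac{1-x}{2}\Big),\qquad -1<x\le 1,$$ be the right generalized Gegenbauer function of fractional degree $\nu$, so that ${}^{r}G_\nu^{(\lambda)}(1)=1$. For $\lambda>0$, $\nu>0$ and $\theta\in(0,\pi)$ define the residual $\mathcal R_\nu^{(\lambda)}(\theta)$ by $$(\sin\theta)^{\lambda}\,{}^{r}G_\nu^{(\lambda)}(\cos\theta)=\frac{2^\lambda\Gamma(\lambda+\frac12)}{\sqrt\pi\,(\nu+\lambda)^\lambda}\cos\big((\nu+\lambda)\theta-\tfrac{\lambda\pi}{2}\big)+\mathcal R_\nu^{(\lambda)}(\theta).$$ Define also, for $\theta\in(0,\pi)$: if $0<\lambda\le 2$ and $\nu+\lambda>1$, $$\mathcal S_\nu^{(\lambda)}(\theta)=\frac{\lambda|\lambda-1|2^\lambda\Gamma(\lambda+\frac12)}{\sqrt\pi(\nu+\lambda-1)^{\lambda+1}}\Big\{|\cot\theta|+\frac23\,\frac{\lambda+1}{\nu+\lambda-1}\Big\};$$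 and if $\lambda>2$ and $\nu>\lambda-3$, $$\mathcal S_\nu^{(\lambda)}(\theta)=\frac{\lambda(\lambda-1)2^{3\lambda/2}\Gamma(\lambda+\frac12)}{\sqrt\pi(\nu+1)^{\lambda+1}}\Big\{|\cot\theta|+\frac23\,\frac{\lambda+1}{\nu+1}+\frac{2^{2-\lambda}\Gamma(2\lambda-1)}{\Gamma(\lambda+1)}\frac{(\nu+1)^{\lambda+1}}{(\nu-\lambda+3)^{2\lambda-1}}|\cot\theta|^{\lambda-2}\Big(|\cot\theta|+\frac23\,\frac{2\lambda-1}{\nu-\lambda+3}\Big)\Big\}.$$ (i) Let $0<\lambda\le 2$, $\nu+\lambda>1$, $\nu>0$. Then $\widetilde{\mathcal R}_\nu^{(\lambda)}(\theta)=\sin\theta\,\mathcal R_\nu^{(\lambda)}(\theta)$ and $\widetilde{\mathcal S}_\nu^{(\lambda)}(\theta)=\sin\theta\,\mathcal S_\nu^{(\lambda)}(\theta)$, $\theta\in(0,\pi)$, extend continuously to $[0,\pi]$, and for the extended functions $$|\widetilde{\mathcal R}_\nu^{(\lambda)}(\theta)|\le\widetilde{\mathcal S}_\nu^{(\lambda)}(\theta)\qquad\text{for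 all }\theta\in[0,\pi],$$ where, for $\theta\in[0,\pi)$, $$\widetilde{\mathcal R}_\nu^{(\lambda)}(\theta)=(\sin\theta)^{\lambda+1}\,{}^{r}G_\nu^{(\lambda)}(\cos\theta)-\frac{2^\lambda\Gamma(\lambda+\frac12)}{\sqrt\pi\,(\nu+\lambda)^\lambda}\sin\theta\,\cos\big((\nu+\lambda)\theta-\tfrac{\lambda\pi}{2}\big).$$ Moreover $\widetilde{\mathcal R}_\nu^{(\lambda)}(0)=0$; $\widetilde{\mathcal R}_\nu^{(\lambda)}(\pi)=0$ if $\lambda<2$; and $\widetilde{\mathcal R}_\nu^{(\lambda)}(\pi)=2^{2\lambda-1}\mathcal Q_\nu^{(\lambda)}$ if $\lambda=2$, where $$\mathcal Q_\nu^{(\lambda)}=-\frac{\sin(\nu\pi)}{\pi}\,\frac{\Gamma(\lambda-\frac12)\Gamma(\lambda+\frac12)\Gamma(\nu+1)}{\Gamma(\nu+2\lambda)}.$$ (ii) Let $\lambda>2$, $\nu>\lambda-3$, $\nu>0$. Then $\widetilde{\mathcal R}_\nu^{(\lambda)}(\theta)=(\sin\theta)^{\lambda-1}\mathcal R_\nu^{(\lambda)}(\theta)$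 and $\widetilde{\mathcal S}_\nu^{(\lambda)}(\theta)=(\sin\theta)^{\lambda-1}\mathcal S_\nu^{(\lambda)}(\theta)$, $\theta\in(0,\pi)$, extend continuously to $[0,\pi]$, and for the extended functions $$|\widetilde{\mathcal R}_\nu^{(\lambda)}(\theta)|\le\widetilde{\mathcal S}_\nu^{(\lambda)}(\theta)\qquad\text{for all }\theta\in[0,\pi],$$ where, for $\theta\in[0,\pi)$, $$\widetilde{\mathcal R}_\nu^{(\lambda)}(\theta)=(\sin\theta)^{2\lambda-1}\,{}^{r}G_\nu^{(\lambda)}(\cos\theta)-\frac{2^\lambda\Gamma(\lambda+\frac12)}{\sqrt\pi\,(\nu+\lambda)^\lambda}(\sin\theta)^{\lambda-1}\cos\big((\nu+\lambda)\theta-\tfrac{\lambda\pi}{2}\big).$$ Moreover $\widetilde{\mathcal R}_\nu^{(\lambda)}(0)=0$ and $\widetilde{\mathcal R}_\nu^{(\lambda)}(\pi)=2^{2\lambda-1}\mathcal Q_\nu^{(\lambda)}$. -/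

import Mathlib

open Real Set

noncomputable section

/-- The right generalized Gegenbauer function of fractional degree `ν` and parameter `lam`,
`₂F₁(-ν, ν + 2 lam; lam + 1/2; (1 - x)/2)`, for `lam > -1/2`, `ν ≥ 0` and `-1 < x ≤ 1`. -/
def rightGGF (lam ν x : ℝ) : ℝ :=
  ₂F₁ (-ν) (ν + 2 * lam) (lam + 1 / 2) ((1 - x) / 2)

/-- The coefficient `2^lam Γ(lam + 1/2) / (√π (ν + lam)^lam)` of the leading term. -/
def leadingCoeff (lam ν : ℝ) : ℝ :=
  2 ^ lam * Gamma (lam + 1 / 2) / (√π * (ν + lam) ^ lam)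

/-- The residual term, that is, `(sin θ)^lam` times the generalized Gegenbauer function at `cos θ`
minus its leading term. It is used for `0 < θ < π`. -/
def gegenbauerResidual (lam ν θ : ℝ) : ℝ :=
  sin θ ^ lam * rightGGF lam ν (cos θ)
    - leadingCoeff lam ν * cos ((ν + lam) * θ - lam * π / 2)

/-- The bound of the residual on `0 < θ < π` in the range `0 < lam ≤ 2`. -/
def residualBoundSmall (lam ν θ : ℝ) : ℝ :=
  lam * |lam - 1| * 2 ^ lam * Gamma (lam + 1 / 2) / (√π * (ν + lam - 1) ^ (lam + 1)) *
    (|cot θ| + 2 / 3 * ((lam + 1) / (ν + lam - 1)))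

/-- The bound of the residual on `0 < θ < π` in the range `lam > 2`. -/
def residualBoundLarge (lam ν θ : ℝ) : ℝ :=
  lam * (lam - 1) * 2 ^ (3 * lam / 2) * Gamma (lam + 1 / 2) / (√π * (ν + 1) ^ (lam + 1)) *
    (|cot θ| + 2 / 3 * ((lam + 1) / (ν + 1))
      + 2 ^ (2 - lam) * Gamma (2 * lam - 1) / Gamma (lam + 1) *
          ((ν + 1) ^ (lam + 1) / (ν - lam + 3) ^ (2 * lam - 1)) * |cot θ| ^ (lam - 2) *
          (|cot θ| + 2 / 3 * ((2 * lam - 1) / (ν - lam + 3))))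

/-- For `lam > 1/2`, the limit of `((1 + x)/2)^(lam - 1/2)` times the generalized Gegenbauer
function as `x` tends to `-1` from the right. -/
def singularLimit (lam ν : ℝ) : ℝ :=
  -(sin (ν * π) / π) *
    (Gamma (lam - 1 / 2) * Gamma (lam + 1 / 2) * Gamma (ν + 1) / Gamma (ν + 2 * lam))

end

/-! Put μ = ν + λ. Up to the constant 2^λ Γ(λ+1/2)/(√π Γ(λ)), the function (sin θ)^λ G(cos θ) is the
real part of e^{i(μθ-λπ/2)} ∫₀^∞ e^{-μt} (sinh t)^{λ-1} (1 + i cot θ tanh(t/2))^{λ-1} dt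
(`sin_rpow_mul_rightGGF`). Replacing sinh t by t and the last factor by 1 leaves a Gamma integral,
which is exactly the leading term. The residual is therefore controlled by the difference of the two
integrands.

That difference is t^{λ-1} e^{-μt} ((1+w)^{λ-1} - 1) with Re w ≥ 0, and the mean value inequality
bounds it by |w| times a bound for |1+sw|^{λ-2}, 0 ≤ s ≤ 1. One factor e^{-t} taken from e^{-μt}
reduces |w| to (2/3)t² + |cot θ| t. For λ ≤ 2 the power is at most 1; for λ > 2 it grows, which
costs further factors e^{-t} and produces the term with |cot θ|^{λ-2}. Gamma integrals then give the
stated constants.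

The integral representation has three ingredients: cos(μφ) is a hypergeometric function of sin²(φ/2)
(`cos_half_mul_hypergeometric`); Bateman's fractional integral and Euler's transformation give the
Mehler–Dirichlet formula (`integral_cos_mul_sub_cos_rpow`); Cauchy's theorem moves the path from [0,
θ] to the vertical ray above θ (`integral_cos_mul_sub_cos_rpow_eq_laplace`).

The value at θ = π needs the growth of ₂F₁ at its singular point 1, obtained by an Abelian
comparison with the binomial series (`tendsto_one_sub_rpow_mul_tsum`). The inequality reaches both
endpoints by continuity. -/

/-! ### Hypergeometric coefficients and the binomial series -/

theorem hypergeometricCoefficient_zero (a b c : ℝ) :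
    ordinaryHypergeometricCoefficient a b c 0 = 1 := by
  simp [ordinaryHypergeometricCoefficient]

theorem hypergeometricCoefficient_succ {c : ℝ} (hc : 0 < c) (a b : ℝ) (n : ℕ) :
    (n + 1) * (n + c) * ordinaryHypergeometricCoefficient a b c (n + 1)
      = (n + a) * (n + b) * ordinaryHypergeometricCoefficient a b c n := by
  have h1 : (c + n : ℝ) ≠ 0 := by positivity
  have h2 : (n + 1 : ℝ) ≠ 0 := by positivity
  have h3 : (n.factorial : ℝ) ≠ 0 := by positivity
  have h4 := (ascPochhammer_pos n c hc).ne'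
  simp only [ordinaryHypergeometricCoefficient, ascPochhammer_succ_eval, Nat.factorial_succ]
  push_cast
  field_simp
  ring

/-- Positivity of c keeps (n+1)(n+c) nonzero, so the recurrence determines the sequence from its
first term. Parameter shifts and Euler's transformation are verified through it. -/
theorem hypergeometricCoefficient_eq_of_recurrence {c : ℝ} (hc : 0 < c) (a b : ℝ) {p : ℕ → ℝ}
    (hp : ∀ n : ℕ, (n + 1) * (n + c) * p (n + 1) = (n + a) * (n + b) * p n) (n : ℕ) :
    p n = p 0 * ordinaryHypergeometricCoefficient a b c n := by
  induction n with
  | zero => rw [hypergeometricCoefficient_zero, mul_one]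
  | succ n ih =>
    have h1 : ((n + 1) * (n + c) : ℝ) ≠ 0 := by positivity
    apply mul_left_cancel₀ h1
    rw [hp, ih]
    linear_combination -p 0 * hypergeometricCoefficient_succ hc a b n

theorem tendsto_add_natCast_ratio (a c : ℝ) :
    Filter.Tendsto (fun n : ℕ => (n + a) / (n + c)) Filter.atTop (nhds 1) := by
  have h (d : ℝ) : Filter.Tendsto (fun n : ℕ => 1 + d / (n : ℝ)) Filter.atTop (nhds 1) := by
    simpa using (tendsto_const_div_atTop_nhds_zero_nat d).const_add 1
  have := (h a).div (h c) one_ne_zero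
  rw [div_one] at this
  refine this.congr' ?_
  filter_upwards [Filter.eventually_gt_atTop 0] with n hn
  have hn' : (n : ℝ) ≠ 0 := by positivity
  simp only [Pi.div_apply]
  rw [show (1 + a / (n : ℝ)) = (n + a) / n by field_simp,
    show (1 + c / (n : ℝ)) = (n + c) / n by field_simp, div_div_div_cancel_right₀ hn']

theorem summable_norm_hypergeometric {c : ℝ} (hc : 0 < c) (a b : ℝ) {x : ℝ} (hx : |x| < 1) :
    Summable fun n => ‖ordinaryHypergeometricCoefficient a b c n * x ^ n‖ := by
  obtain ⟨r, hr1, hr2⟩ := exists_between hx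
  refine summable_of_ratio_norm_eventually_le hr2 ?_
  have hlim : Filter.Tendsto (fun n : ℕ => |(n + a) / (n + 1) * ((n + b) / (n + c)) * x|)
      Filter.atTop (nhds |1 * 1 * x|) :=
    (((tendsto_add_natCast_ratio a 1).mul (tendsto_add_natCast_ratio b c)).mul_const x).abs
  rw [one_mul, one_mul] at hlim
  filter_upwards [hlim.eventually (gt_mem_nhds hr1)] with n hn
  have h1 : (n + 1 : ℝ) ≠ 0 := by positivity
  have h2 : (n + c : ℝ) ≠ 0 := by positivity
  have h3 : ordinaryHypergeometricCoefficient a b c (n + 1) * x ^ (n + 1)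
      = ((n + a) / (n + 1) * ((n + b) / (n + c)) * x)
        * (ordinaryHypergeometricCoefficient a b c n * x ^ n) := by
    have := hypergeometricCoefficient_succ hc a b n
    have h4 : ordinaryHypergeometricCoefficient a b c (n + 1)
        = (n + a) * (n + b) * ordinaryHypergeometricCoefficient a b c n / ((n + 1) * (n + c)) := by
      rw [← this]; field_simp
    rw [h4, pow_succ]
    field_simp
  rw [norm_norm, norm_norm, h3, norm_mul]
  exact mul_le_mul_of_nonneg_right hn.le (norm_nonneg _)

theorem hypergeometric_eq_tsum (a b c x : ℝ) :
    ₂F₁ a b c x = ∑' n : ℕ, ordinaryHypergeometricCoefficient a b c n * x ^ n := by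
  rw [ordinaryHypergeometric_eq_tsum]
  rfl

theorem hasSum_hypergeometric {c : ℝ} (hc : 0 < c) (a b : ℝ) {x : ℝ} (hx : |x| < 1) :
    HasSum (fun n => ordinaryHypergeometricCoefficient a b c n * x ^ n) (₂F₁ a b c x) := by
  rw [hypergeometric_eq_tsum]
  exact (summable_norm_hypergeometric hc a b hx).of_norm.hasSum

/-- The parameters 1 and 1 cancel and leave the binomial series. It is a factor in Euler's
transformation and the comparison series of the Abelian theorem. -/
theorem hypergeometric_one_one (s : ℝ) {x : ℝ} (hx : |x| < 1) :
    ₂F₁ s 1 1 x = (1 - x) ^ (-s) := by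
  have h := (Real.one_div_one_sub_rpow_hasFPowerSeriesOnBall_zero s).hasSum (y := x) (by
    simpa [enorm_eq_nnnorm, ← NNReal.coe_lt_coe] using hx)
  have hx' : 0 ≤ 1 - x := by linarith [(abs_lt.mp hx).2]
  rw [zero_add, one_div, ← Real.rpow_neg hx'] at h
  refine (hasSum_hypergeometric one_pos s 1 hx).unique ?_
  refine h.congr_fun ?_
  intro n
  rw [FormalMultilinearSeries.ofScalars_apply_eq, smul_eq_mul]
  congr 1
  rw [← Ring.multichoose_eq]
  have h1 := Ring.factorial_nsmul_multichoose_eq_ascPochhammer s n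
  rw [Polynomial.ascPochhammer_smeval_eq_eval, nsmul_eq_mul] at h1
  have h2 := (ascPochhammer_pos n (1 : ℝ) one_pos).ne'
  have h3 : (n.factorial : ℝ) ≠ 0 := by positivity
  rw [ordinaryHypergeometricCoefficient, ← h1]
  field_simp

/-! ### Euler's transformation by formal power series -/

-- The hypergeometric differential operator acts on coefficients through the two-term recurrence, so
-- a series that it annihilates is known from its constant term.
open PowerSeries in
theorem coeff_hypergeometric_operator (a b c : ℝ) (P : PowerSeries ℝ) (n : ℕ) :
    coeff n (X * (1 - X) * derivative ℝ (derivative ℝ P)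
      + (C c - C (a + b + 1) * X) * derivative ℝ P - C (a * b) * P)
      = (n + 1) * (n + c) * coeff (n + 1) P - (n + a) * (n + b) * coeff n P := by
  have e : X * (1 - X) * derivative ℝ (derivative ℝ P)
      + (C c - C (a + b + 1) * X) * derivative ℝ P - C (a * b) * P
      = X * derivative ℝ (derivative ℝ P) - X * (X * derivative ℝ (derivative ℝ P))
        + C c * derivative ℝ P - C (a + b + 1) * (X * derivative ℝ P) - C (a * b) * P := by ring
  rw [e]
  -- Naming the constants keeps the simp set from rewriting inside `C`.
  obtain ⟨d, hd⟩ : ∃ d, d = a + b + 1 := ⟨_, rfl⟩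
  obtain ⟨f, hf⟩ : ∃ f, f = a * b := ⟨_, rfl⟩
  rw [← hd, ← hf]
  simp only [map_add, map_sub, coeff_C_mul]
  rcases n with _ | _ | n
  · simp only [coeff_derivative, coeff_zero_X_mul]
    push_cast
    rw [hf]
    ring
  · simp only [coeff_derivative, coeff_succ_X_mul, zero_add, coeff_zero_X_mul]
    push_cast
    rw [hf, hd]
    ring
  · simp only [coeff_derivative, coeff_succ_X_mul]
    push_cast
    rw [hf, hd]
    ring

-- The product B * H on the right has constant term 1 and satisfies the hypergeometric equation with
-- parameters a, b, c: this follows from the first-order equation of the binomial factor B and the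
-- second-order equation of H.
open PowerSeries in
theorem mk_hypergeometricCoefficient_euler {c : ℝ} (hc : 0 < c) (a b : ℝ) :
    (mk (ordinaryHypergeometricCoefficient a b c) : PowerSeries ℝ)
      = mk (ordinaryHypergeometricCoefficient (a + b - c) 1 1)
        * mk (ordinaryHypergeometricCoefficient (c - a) (c - b) c) := by
  set s := a + b - c with hs
  set B : PowerSeries ℝ := mk (ordinaryHypergeometricCoefficient s 1 1) with hB
  set H : PowerSeries ℝ := mk (ordinaryHypergeometricCoefficient (c - a) (c - b) c) with hH
  have hB1 : (1 - X) * derivative ℝ B = C s * B := by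
    ext n
    have e : (1 - X) * derivative ℝ B = derivative ℝ B - X * derivative ℝ B := by ring
    rw [e, map_sub, coeff_derivative, coeff_C_mul]
    have := hypergeometricCoefficient_succ one_pos s 1 n
    have h1 : (n + 1 : ℝ) ≠ 0 := by positivity
    have h2 : (n + 1) * ordinaryHypergeometricCoefficient s 1 1 (n + 1)
        = (n + s) * ordinaryHypergeometricCoefficient s 1 1 n := by
      apply mul_left_cancel₀ h1; linear_combination this
    rcases n with _ | n
    · simp only [hB, coeff_mk, coeff_zero_X_mul]
      push_cast at h2 ⊢
      linear_combination h2
    · rw [coeff_succ_X_mul, coeff_derivative]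
      simp only [hB, coeff_mk]
      push_cast at h2 ⊢
      linear_combination h2
  have hB2 : (1 - X) * derivative ℝ (derivative ℝ B) = C (s + 1) * derivative ℝ B := by
    have := congrArg (derivative ℝ) hB1
    simp only [Derivation.leibniz, map_sub, derivative_one, derivative_X, derivative_C,
      smul_eq_mul] at this
    rw [map_add, map_one]
    linear_combination this
  have hH0 : X * (1 - X) * derivative ℝ (derivative ℝ H)
      + (C c - C ((c - a) + (c - b) + 1) * X) * derivative ℝ H - C ((c - a) * (c - b)) * H = 0 := by
    ext n
    rw [coeff_hypergeometric_operator, map_zero, hH, coeff_mk, coeff_mk, sub_eq_zero]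
    exact hypergeometricCoefficient_succ hc _ _ n
  have hX : (1 - X : PowerSeries ℝ) ≠ 0 := by
    intro h
    have := congrArg (coeff 0) h
    simp at this
  have hP : X * (1 - X) * derivative ℝ (derivative ℝ (B * H))
      + (C c - C (a + b + 1) * X) * derivative ℝ (B * H) - C (a * b) * (B * H) = 0 := by
    -- The equations for B carry a factor 1 - X, so the claim is multiplied by it; power series over
    -- ℝ form a domain.
    apply mul_left_cancel₀ hX
    rw [mul_zero]
    have hsC : (C s : PowerSeries ℝ) = C a + C b - C c := by rw [hs, map_sub, map_add]
    simp only [Derivation.leibniz, smul_eq_mul, map_add]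
    simp only [map_add, map_sub, map_mul, map_one] at hH0 hB2 hB1 ⊢
    rw [hsC] at hB1 hB2
    generalize derivative ℝ (derivative ℝ B) = B2 at *
    generalize derivative ℝ (derivative ℝ H) = H2 at *
    generalize derivative ℝ B = B1 at *
    generalize derivative ℝ H = H1 at *
    linear_combination (1 - X) * B * hH0 + (1 - X) * X * H * hB2
      + (2 * X * (1 - X) * H1 + (C c - (C a + C b + 1) * X) * H + X * H * (C a + C b - C c + 1)) * hB1
  ext n
  rw [coeff_mk]
  have h0 : coeff 0 (B * H) = 1 := by
    simp [coeff_mul, hB, hH, ordinaryHypergeometricCoefficient]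
  refine ((hypergeometricCoefficient_eq_of_recurrence hc a b (p := fun n => coeff n (B * H))
    (fun n => ?_) n).trans ?_).symm
  · have := congrArg (coeff n) hP
    rw [coeff_hypergeometric_operator, map_zero, sub_eq_zero] at this
    exact this
  · simp only [h0, one_mul]

/-- Euler's transformation of the hypergeometric function. -/
theorem hypergeometric_euler {c : ℝ} (hc : 0 < c) (a b : ℝ) {x : ℝ} (hx : |x| < 1) :
    ₂F₁ a b c x = (1 - x) ^ (c - a - b) * ₂F₁ (c - a) (c - b) c x := by
  have h := tsum_mul_tsum_eq_tsum_sum_antidiagonal_of_summable_norm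
    (summable_norm_hypergeometric one_pos (a + b - c) 1 hx)
    (summable_norm_hypergeometric hc (c - a) (c - b) hx)
  rw [← hypergeometric_eq_tsum, ← hypergeometric_eq_tsum, hypergeometric_one_one _ hx,
    show -(a + b - c) = c - a - b by ring] at h
  rw [h, hypergeometric_eq_tsum]
  refine tsum_congr fun n => ?_
  have := congrArg (PowerSeries.coeff n) (mk_hypergeometricCoefficient_euler hc a b)
  rw [PowerSeries.coeff_mk, PowerSeries.coeff_mul] at this
  rw [this, Finset.sum_mul]
  refine Finset.sum_congr rfl fun kl hkl => ?_
  rw [PowerSeries.coeff_mk, PowerSeries.coeff_mk, ← Finset.HasAntidiagonal.mem_antidiagonal.mp hkl, pow_add]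
  ring

/-! ### Differentiation and a contiguous relation -/

theorem succ_mul_hypergeometricCoefficient_succ {c : ℝ} (hc : 0 < c) (a b : ℝ) (n : ℕ) :
    (n + 1) * ordinaryHypergeometricCoefficient a b c (n + 1)
      = a * b / c * ordinaryHypergeometricCoefficient (a + 1) (b + 1) (c + 1) n := by
  have h := hypergeometricCoefficient_eq_of_recurrence (c := c + 1) (by linarith) (a + 1) (b + 1)
    (p := fun n : ℕ => (n + 1) * ordinaryHypergeometricCoefficient a b c (n + 1)) (fun n => by
      have := hypergeometricCoefficient_succ hc a b (n + 1)
      push_cast at this ⊢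
      linear_combination (n + 1 : ℝ) * this) n
  have h0 := hypergeometricCoefficient_succ hc a b 0
  rw [hypergeometricCoefficient_zero] at h0
  simp only [h]
  congr 1
  field_simp
  push_cast at h0 ⊢
  linear_combination h0

theorem hasDerivAt_hypergeometric {c : ℝ} (hc : 0 < c) (a b : ℝ) {x : ℝ} (hx : |x| < 1) :
    HasDerivAt (₂F₁ a b c) (a * b / c * ₂F₁ (a + 1) (b + 1) (c + 1) x) x := by
  obtain ⟨r, hr1, hr2⟩ := exists_between hx
  have hr0 : 0 < r := (abs_nonneg x).trans_lt hr1
  have hc1 : 0 < c + 1 := by linarith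
  obtain ⟨h, hh⟩ : ∃ h, h = ordinaryHypergeometricCoefficient a b c := ⟨_, rfl⟩
  have key (y : ℝ) : (fun n : ℕ => h (n + 1) * ((n + 1 : ℕ) * y ^ (n + 1 - 1))) = fun n : ℕ =>
      a * b / c * (ordinaryHypergeometricCoefficient (a + 1) (b + 1) (c + 1) n * y ^ n) := by
    funext n
    rw [← mul_assoc, ← mul_assoc, ← succ_mul_hypergeometricCoefficient_succ hc, hh,
      Nat.add_sub_cancel]
    push_cast
    ring
  have hu : Summable fun n : ℕ => ‖h n * (n * r ^ (n - 1))‖ := by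
    rw [← summable_nat_add_iff 1]
    have : (fun n : ℕ => ‖h (n + 1) * ((n + 1 : ℕ) * r ^ (n + 1 - 1))‖) = fun n : ℕ =>
        ‖a * b / c‖ *
          ‖ordinaryHypergeometricCoefficient (a + 1) (b + 1) (c + 1) n * r ^ n‖ := by
      funext n
      rw [← norm_mul]
      exact congrArg norm (congrFun (key r) n)
    rw [this]
    exact (summable_norm_hypergeometric hc1 _ _ (by rwa [abs_of_pos hr0])).mul_left _
  have hF : ₂F₁ a b c = fun y : ℝ => ∑' n, h n * y ^ n := hh ▸ funext (hypergeometric_eq_tsum a b c)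
  rw [hF]
  have hx' : x ∈ Ioo (-r) r := abs_lt.mp hr1
  have hD := hasDerivAt_tsum_of_isPreconnected (𝕜 := ℝ) (t := Ioo (-r) r)
    (g := fun n y => h n * y ^ n) (g' := fun n y => h n * (n * y ^ (n - 1))) (y₀ := x) (y := x)
    hu isOpen_Ioo isPreconnected_Ioo (fun n y _ => (hasDerivAt_pow n y).const_mul _)
    (fun n y hy => by
      rw [norm_mul, norm_mul, norm_mul, norm_mul, norm_pow, norm_pow, Real.norm_of_nonneg hr0.le]
      have : ‖y‖ ≤ r := (abs_lt.mpr hy).le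
      gcongr)
    hx' (hh ▸ (summable_norm_hypergeometric hc a b hx).of_norm) hx'
  refine hD.congr_deriv ?_
  have hs := ((hasSum_hypergeometric hc1 (a + 1) (b + 1) hx).mul_left (a * b / c))
  rw [← key x] at hs
  have hs' := (hasSum_nat_add_iff (f := fun n : ℕ => h n * (n * x ^ (n - 1))) 1).mp hs
  simp only [Finset.range_one, Finset.sum_singleton, Nat.cast_zero, zero_mul, mul_zero,
    add_zero] at hs'
  exact hs'.tsum_eq

theorem hypergeometricCoefficient_lower_succ {c : ℝ} (hc : 0 < c) (a b : ℝ) (n : ℕ) :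
    (n + c) * ordinaryHypergeometricCoefficient a b (c + 1) n
      = c * ordinaryHypergeometricCoefficient a b c n := by
  have h := hypergeometricCoefficient_eq_of_recurrence hc a b
    (p := fun n : ℕ => (n + c) * ordinaryHypergeometricCoefficient a b (c + 1) n) (fun n => by
      have := hypergeometricCoefficient_succ (c := c + 1) (by linarith) a b n
      push_cast at this ⊢
      linear_combination (n + c) * this) n
  simpa [hypergeometricCoefficient_zero] using h

/-- In `hypergeometricCoefficient_lower_succ` the factor n becomes the operator x d/dx on series,
which is the second summand here. -/
theorem hypergeometric_lower_succ {c : ℝ} (hc : 0 < c) (a b : ℝ) {x : ℝ} (hx : |x| < 1) :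
    c * ₂F₁ a b (c + 1) x + x * (a * b / (c + 1) * ₂F₁ (a + 1) (b + 1) (c + 1 + 1) x)
      = c * ₂F₁ a b c x := by
  have hc1 : 0 < c + 1 := by linarith
  have hc2 : 0 < c + 1 + 1 := by linarith
  have h1 := (hasSum_hypergeometric hc2 (a + 1) (b + 1) hx).mul_left (x * (a * b / (c + 1)))
  have e : (fun n : ℕ => x * (a * b / (c + 1)) *
      (ordinaryHypergeometricCoefficient (a + 1) (b + 1) (c + 1 + 1) n * x ^ n)) = fun n : ℕ =>
      ((n + 1 : ℕ) : ℝ) * (ordinaryHypergeometricCoefficient a b (c + 1) (n + 1) * x ^ (n + 1)) := by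
    funext n
    have := succ_mul_hypergeometricCoefficient_succ hc1 a b n
    push_cast
    linear_combination -x ^ (n + 1) * this
  rw [e] at h1
  have h2 := (hasSum_nat_add_iff (f := fun n : ℕ =>
    (n : ℝ) * (ordinaryHypergeometricCoefficient a b (c + 1) n * x ^ n)) 1).mp h1
  simp only [Finset.range_one, Finset.sum_singleton, Nat.cast_zero, zero_mul, add_zero] at h2
  have h3 := ((hasSum_hypergeometric hc1 a b hx).mul_left c).add h2
  have h4 := (hasSum_hypergeometric hc a b hx).mul_left c
  rw [← mul_assoc]
  refine h3.unique (h4.congr_fun fun n => ?_)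
  have := hypergeometricCoefficient_lower_succ hc a b n
  linear_combination x ^ n * this

/-! ### The cosine as a hypergeometric function of sin²(φ/2) -/

theorem cos_half_pos {φ : ℝ} (hφ : φ ∈ Ioo (-π) π) : 0 < cos (φ / 2) :=
  cos_pos_of_mem_Ioo ⟨by linarith [hφ.1], by linarith [hφ.2]⟩

theorem abs_sin_sq_half_lt_one {φ : ℝ} (hφ : φ ∈ Ioo (-π) π) : |sin (φ / 2) ^ 2| < 1 := by
  have := cos_half_pos hφ
  rw [abs_of_nonneg (sq_nonneg _), sin_sq]
  nlinarith

theorem one_sub_sin_sq_half_rpow {φ : ℝ} (hφ : φ ∈ Ioo (-π) π) (r : ℝ) :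
    (1 - sin (φ / 2) ^ 2) ^ r = cos (φ / 2) ^ (2 * r) := by
  rw [← cos_sq', rpow_mul (cos_half_pos hφ).le, rpow_two]

/-- The left side u and a companion v solve u' = -μ²v, v' = u with u(0) = 1, v(0) = 0, the system of
cos(μt) and sin(μt)/μ. -/
theorem cos_half_mul_hypergeometric (μ : ℝ) {φ : ℝ} (hφ : φ ∈ Ioo (-π) π) :
    cos (φ / 2) * ₂F₁ (1 / 2 + μ) (1 / 2 - μ) (1 / 2) (sin (φ / 2) ^ 2) = cos (μ * φ) := by
  have hx (t : ℝ) : HasDerivAt (fun t => sin (t / 2) ^ 2) (sin (t / 2) * cos (t / 2)) t := by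
    have := (((hasDerivAt_id t).div_const 2).sin).pow 2
    refine this.congr_deriv ?_
    simp
    ring
  have hE {t : ℝ} (ht : t ∈ Ioo (-π) π) :
      cos (t / 2) * ₂F₁ (1 / 2 + μ) (1 / 2 - μ) (1 / 2) (sin (t / 2) ^ 2)
        = ₂F₁ (-μ) μ (1 / 2) (sin (t / 2) ^ 2) := by
    rw [hypergeometric_euler (by norm_num) (1 / 2 + μ) (1 / 2 - μ) (abs_sin_sq_half_lt_one ht),
      one_sub_sin_sq_half_rpow ht, show 2 * (1 / 2 - (1 / 2 + μ) - (1 / 2 - μ)) = (-1 : ℝ) by ring,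
      rpow_neg_one, mul_inv_cancel_left₀ (cos_half_pos ht).ne']
    congr 1 <;> ring
  have hE' {t : ℝ} (ht : t ∈ Ioo (-π) π) :
      cos (t / 2) * ₂F₁ (-μ + 1) (μ + 1) (1 / 2 + 1) (sin (t / 2) ^ 2)
        = ₂F₁ (1 / 2 + μ) (1 / 2 - μ) (1 / 2 + 1) (sin (t / 2) ^ 2) := by
    rw [hypergeometric_euler (by norm_num) (-μ + 1) (μ + 1) (abs_sin_sq_half_lt_one ht),
      one_sub_sin_sq_half_rpow ht, show 2 * (1 / 2 + 1 - (-μ + 1) - (μ + 1)) = (-1 : ℝ) by ring,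
      rpow_neg_one, mul_inv_cancel_left₀ (cos_half_pos ht).ne']
    congr 1 <;> ring
  set u : ℝ → ℝ := fun t => ₂F₁ (-μ) μ (1 / 2) (sin (t / 2) ^ 2) with hu
  set v : ℝ → ℝ := fun t =>
    2 * sin (t / 2) * ₂F₁ (1 / 2 + μ) (1 / 2 - μ) (1 / 2 + 1) (sin (t / 2) ^ 2) with hv
  have hu' {t : ℝ} (ht : t ∈ Ioo (-π) π) : HasDerivAt u (-μ ^ 2 * v t) t := by
    have := (hasDerivAt_hypergeometric (c := 1 / 2) (by norm_num) (-μ) μ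
      (abs_sin_sq_half_lt_one ht)).comp t (hx t)
    refine this.congr_deriv ?_
    simp only [hv, ← hE' ht]
    ring
  have hv' {t : ℝ} (ht : t ∈ Ioo (-π) π) : HasDerivAt v (u t) t := by
    have h1 := (hasDerivAt_hypergeometric (c := 1 / 2 + 1) (by norm_num) (1 / 2 + μ) (1 / 2 - μ)
      (abs_sin_sq_half_lt_one ht)).comp t (hx t)
    have h2 := ((((hasDerivAt_id t).div_const 2).sin).const_mul 2).mul h1
    refine h2.congr_deriv ?_
    have h3 := hypergeometric_lower_succ (c := 1 / 2) (by norm_num) (1 / 2 + μ) (1 / 2 - μ)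
      (abs_sin_sq_half_lt_one ht)
    simp only [hu, ← hE ht, Function.comp_apply, id_eq]
    linear_combination 2 * cos (t / 2) * h3
  have hcos (t : ℝ) : HasDerivAt (fun t => cos (μ * t)) (-sin (μ * t) * μ) t := by
    simpa using ((hasDerivAt_id t).const_mul μ).cos
  have hsin (t : ℝ) : HasDerivAt (fun t => sin (μ * t)) (cos (μ * t) * μ) t := by
    simpa using ((hasDerivAt_id t).const_mul μ).sin
  have hconst {f : ℝ → ℝ} (hf : ∀ t ∈ Ioo (-π) π, HasDerivAt f 0 t) : f φ = f 0 := by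
    refine (convex_Ioo (-π) π).is_const_of_fderivWithin_eq_zero (𝕜 := ℝ)
      (fun t ht => (hf t ht).differentiableAt.differentiableWithinAt) (fun t ht => ?_) hφ
      ⟨by linarith [pi_pos], pi_pos⟩
    rw [fderivWithin_of_isOpen isOpen_Ioo ht, (hf t ht).hasFDerivAt.fderiv]
    simp
  -- Two first integrals of the system, equal to 1 and 0; together they give u = cos(μφ) without
  -- dividing by μ.
  have h1 := hconst (f := fun t => u t * cos (μ * t) + μ * (v t * sin (μ * t))) fun t ht => by
    refine (((hu' ht).mul (hcos t)).add (((hv' ht).mul (hsin t)).const_mul μ)).congr_deriv ?_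
    ring
  have h2 := hconst (f := fun t => u t * sin (μ * t) - μ * (v t * cos (μ * t))) fun t ht => by
    refine (((hu' ht).mul (hsin t)).sub (((hv' ht).mul (hcos t)).const_mul μ)).congr_deriv ?_
    ring
  have hu0 : u 0 = 1 := by simp [hu]
  have hv0 : v 0 = 0 := by simp [hv]
  simp only [hu0, hv0, mul_zero, cos_zero, sin_zero, mul_one, add_zero, sub_zero] at h1 h2
  rw [hE hφ]
  change u φ = _
  linear_combination cos (μ * φ) * h1 + sin (μ * φ) * h2 - u φ * sin_sq_add_cos_sq (μ * φ)

/-! ### Behaviour of the hypergeometric function at 1 -/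

theorem hypergeometricCoefficient_one_one_pos {s : ℝ} (hs : 0 < s) (n : ℕ) :
    0 < ordinaryHypergeometricCoefficient s 1 1 n := by
  have h1 := ascPochhammer_pos n s hs
  have h2 := ascPochhammer_pos n (1 : ℝ) one_pos
  unfold ordinaryHypergeometricCoefficient
  positivity

open Filter Topology in
/-- An Abelian theorem: the growth of a power series at `1` is that of the binomial series with
which its coefficients compare. -/
theorem tendsto_one_sub_rpow_mul_tsum {s L : ℝ} (hs : 0 < s) {w : ℕ → ℝ}
    (hw : ∀ x ∈ Ioo (0 : ℝ) 1, Summable fun n => w n * x ^ n)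
    (hL : Tendsto (fun n => w n / ordinaryHypergeometricCoefficient s 1 1 n) atTop (𝓝 L)) :
    Tendsto (fun x => (1 - x) ^ s * ∑' n, w n * x ^ n) (𝓝[<] 1) (𝓝 L) := by
  obtain ⟨v, hv⟩ : ∃ v, v = ordinaryHypergeometricCoefficient s 1 1 := ⟨_, rfl⟩
  have hv0 : ∀ n, 0 < v n := fun n => hv ▸ hypergeometricCoefficient_one_one_pos hs n
  rw [← hv] at hL
  rw [Metric.tendsto_nhds]
  intro ε hε
  obtain ⟨N, hN⟩ := (Metric.tendsto_atTop.mp hL) (ε / 2) (half_pos hε)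
  -- The terms before N contribute at most C, which the factor (1 - x)^s sends to 0; the later ones
  -- are within ε/2 of the binomial series.
  set C := ∑ n ∈ Finset.range N, |w n - L * v n| with hC
  have hlim : Tendsto (fun x : ℝ => C * (1 - x) ^ s) (𝓝[<] 1) (𝓝 (C * (1 - 1) ^ s)) := by
    refine Tendsto.mono_left ?_ nhdsWithin_le_nhds
    exact (((continuous_const.sub continuous_id).continuousAt).rpow_const (Or.inr hs.le)).const_mul C
  rw [sub_self, zero_rpow hs.ne', mul_zero] at hlim
  have hI : ∀ᶠ x : ℝ in 𝓝[<] 1, x ∈ Ioo (0 : ℝ) 1 := Ioo_mem_nhdsLT one_pos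
  filter_upwards [hI, hlim.eventually (gt_mem_nhds (half_pos hε))] with x hx hCx
  have hx1 : 0 < 1 - x := by linarith [hx.2]
  have hp : 0 < (1 - x) ^ s := rpow_pos_of_pos hx1 s
  have hV : HasSum (fun n => v n * x ^ n) ((1 - x) ^ (-s)) := by
    have hxa : |x| < 1 := by rw [abs_of_pos hx.1]; exact hx.2
    rw [← hypergeometric_one_one s hxa, hv]
    exact hasSum_hypergeometric one_pos s 1 hxa
  have hW := (hw x hx).hasSum
  have hD := hW.sub (hV.mul_left L)
  have hB : HasSum (fun n => (if n < N then |w n - L * v n| else 0) + ε / 2 * (v n * x ^ n))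
      (C + ε / 2 * (1 - x) ^ (-s)) := by
    refine HasSum.add ?_ (hV.mul_left _)
    have : HasSum (fun n => if n < N then |w n - L * v n| else 0) _ :=
      hasSum_sum_of_ne_finset_zero (s := Finset.range N) (f := fun n => if n < N then |w n - L * v n| else 0) (fun n hn => by
        simp only [Finset.mem_range] at hn
        simp [hn])
    rwa [Finset.sum_congr rfl fun n hn => if_pos (Finset.mem_range.mp hn)] at this
  have hle := tsum_of_norm_bounded hB (f := fun n => w n * x ^ n - L * (v n * x ^ n)) fun n => by
    have hxn : 0 < x ^ n := pow_pos hx.1 n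
    rw [← mul_assoc, ← sub_mul, norm_mul, Real.norm_of_nonneg hxn.le, Real.norm_eq_abs]
    split_ifs with hn
    · have : |w n - L * v n| * x ^ n ≤ |w n - L * v n| :=
        mul_le_of_le_one_right (abs_nonneg _) (pow_le_one₀ hx.1.le hx.2.le)
      have := mul_pos (half_pos hε) (mul_pos (hv0 n) hxn)
      linarith
    · have h1 := (hN n (not_lt.mp hn)).le
      rw [Real.dist_eq, div_sub' (hv0 n).ne', abs_div, abs_of_pos (hv0 n),
        div_le_iff₀ (hv0 n), mul_comm (v n) L] at h1
      have := mul_le_mul_of_nonneg_right h1 hxn.le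
      linarith
  rw [hD.tsum_eq, Real.norm_eq_abs] at hle
  have hpp : (1 - x) ^ s * (1 - x) ^ (-s) = 1 := by
    rw [← rpow_add hx1, add_neg_cancel, rpow_zero]
  rw [Real.dist_eq]
  have e : (1 - x) ^ s * ∑' n, w n * x ^ n - L
      = (1 - x) ^ s * (∑' n, w n * x ^ n - L * (1 - x) ^ (-s)) := by
    linear_combination L * hpp
  rw [e, abs_mul, abs_of_pos hp]
  calc _ ≤ (1 - x) ^ s * (C + ε / 2 * (1 - x) ^ (-s)) := mul_le_mul_of_nonneg_left hle hp.le
    _ = C * (1 - x) ^ s + ε / 2 := by linear_combination ε / 2 * hpp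
    _ < ε := by linarith

theorem ascPochhammer_succ_eq_GammaSeq_inv (s : ℝ) {n : ℕ} (hn : n ≠ 0) :
    (ascPochhammer ℝ (n + 1)).eval s = (n : ℝ) ^ s * n.factorial * (GammaSeq s n)⁻¹ := by
  have h1 : (n : ℝ) ^ s * n.factorial ≠ 0 := by positivity
  rw [GammaSeq, inv_div, mul_div_cancel₀ _ h1]
  clear h1 hn
  induction n with
  | zero => simp
  | succ n ih => rw [ascPochhammer_succ_eval, ih, Finset.prod_range_succ _ (n + 1)]

-- Reciprocals are needed because -ν may be a pole of Γ. There division by zero makes `GammaSeq`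
-- eventually 0 and `Gamma` is 0 by convention, so the inverses take the correct value 0 of 1/Γ.
open Filter Topology in
theorem tendsto_GammaSeq_inv (s : ℝ) :
    Tendsto (fun n => (GammaSeq s n)⁻¹) atTop (𝓝 (Gamma s)⁻¹) := by
  by_cases h : Gamma s = 0
  · obtain ⟨m, rfl⟩ := (Gamma_eq_zero_iff s).mp h
    rw [h, inv_zero]
    refine tendsto_const_nhds.congr' ?_
    filter_upwards [eventually_ge_atTop m] with n hn
    rw [GammaSeq, Finset.prod_eq_zero (Finset.mem_range.mpr (Nat.lt_succ_of_le hn)) (by simp)]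
    simp
  · exact (GammaSeq_tendsto_Gamma s).inv₀ h

-- Each Pochhammer symbol is a power of n times n! over Euler's Gamma sequence, and the powers
-- collect to n^(a+b-c-s). Leaving L free serves the critical exponent (L = 1) and larger s (L = 0).
open Filter Topology in
theorem tendsto_hypergeometricCoefficient_ratio {c s : ℝ} (hc : 0 < c) (hs : 0 < s) (a b : ℝ)
    {L : ℝ} (hL : Tendsto (fun n : ℕ => (n : ℝ) ^ (a + b - c - s)) atTop (𝓝 L)) :
    Tendsto (fun n => ordinaryHypergeometricCoefficient a b c n /
        ordinaryHypergeometricCoefficient s 1 1 n) atTop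
      (𝓝 (L * ((Gamma a)⁻¹ * (Gamma b)⁻¹ * (Gamma c * Gamma s)))) := by
  rw [← tendsto_add_atTop_iff_nat 1]
  refine (hL.mul (((tendsto_GammaSeq_inv a).mul (tendsto_GammaSeq_inv b)).mul
    ((GammaSeq_tendsto_Gamma c).mul (GammaSeq_tendsto_Gamma s)))).congr' ?_
  filter_upwards [eventually_gt_atTop 0] with n hn
  have hn' : (0 : ℝ) < n := by exact_mod_cast hn
  have h1 := (ascPochhammer_pos (n + 1) (1 : ℝ) one_pos).ne'
  have h2 := (ascPochhammer_pos (n + 1) c hc).ne'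
  have h3 := (ascPochhammer_pos (n + 1) s hs).ne'
  have h4 : ((n + 1).factorial : ℝ) ≠ 0 := by positivity
  have e : ordinaryHypergeometricCoefficient a b c (n + 1) /
      ordinaryHypergeometricCoefficient s 1 1 (n + 1)
      = (ascPochhammer ℝ (n + 1)).eval a * (ascPochhammer ℝ (n + 1)).eval b *
        ((ascPochhammer ℝ (n + 1)).eval c)⁻¹ * ((ascPochhammer ℝ (n + 1)).eval s)⁻¹ := by
    unfold ordinaryHypergeometricCoefficient
    field_simp
  rw [e]
  simp only [ascPochhammer_succ_eq_GammaSeq_inv _ hn.ne', mul_inv, inv_inv]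
  rw [rpow_sub hn', rpow_sub hn', rpow_add hn']
  have := (rpow_pos_of_pos hn' c).ne'
  have := (rpow_pos_of_pos hn' s).ne'
  have : (n.factorial : ℝ) ≠ 0 := by positivity
  field_simp

open Filter Topology in
theorem tendsto_one_sub_rpow_mul_hypergeometric {c s : ℝ} (hc : 0 < c) (hs : 0 < s) (a b : ℝ)
    {L : ℝ} (hL : Tendsto (fun n : ℕ => (n : ℝ) ^ (a + b - c - s)) atTop (𝓝 L)) :
    Tendsto (fun x => (1 - x) ^ s * ₂F₁ a b c x) (𝓝[<] 1)
      (𝓝 (L * ((Gamma a)⁻¹ * (Gamma b)⁻¹ * (Gamma c * Gamma s)))) := by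
  simp only [hypergeometric_eq_tsum]
  exact tendsto_one_sub_rpow_mul_tsum hs
    (fun x hx => (summable_norm_hypergeometric hc a b
      (by rw [abs_of_pos hx.1]; exact hx.2)).of_norm)
    (tendsto_hypergeometricCoefficient_ratio hc hs a b hL)

open Filter Topology in
/-- The behaviour of the hypergeometric function at its singular point `1`. -/
theorem tendsto_hypergeometric_singular {a b c : ℝ} (hc : 0 < c) (hs : 0 < a + b - c) :
    Tendsto (fun x => (1 - x) ^ (a + b - c) * ₂F₁ a b c x) (𝓝[<] 1)
      (𝓝 ((Gamma a)⁻¹ * (Gamma b)⁻¹ * (Gamma c * Gamma (a + b - c)))) := by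
  have := tendsto_one_sub_rpow_mul_hypergeometric hc hs a b (L := 1) (by simp)
  rwa [one_mul] at this

open Filter Topology in
theorem tendsto_one_sub_rpow_mul_hypergeometric_zero {a b c s : ℝ} (hc : 0 < c) (hs : 0 < s)
    (h : a + b - c < s) : Tendsto (fun x : ℝ => (1 - x) ^ s * ₂F₁ a b c x) (𝓝[<] 1) (𝓝 0) := by
  have := tendsto_one_sub_rpow_mul_hypergeometric hc hs a b (L := 0) (by
    have := (tendsto_rpow_neg_atTop (y := s - (a + b - c)) (by linarith)).comp
      tendsto_natCast_atTop_atTop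
    simpa [Function.comp_def] using this)
  rwa [zero_mul] at this

/-! ### Beta integrals and the Mehler–Dirichlet formula -/

theorem Gamma_add_natCast_eq {s : ℝ} (hs : 0 < s) (n : ℕ) :
    Gamma (s + n) = (ascPochhammer ℝ n).eval s * Gamma s := by
  induction n with
  | zero => simp
  | succ n ih =>
    rw [Nat.cast_succ, ← add_assoc, Gamma_add_one (by positivity), ih, ascPochhammer_succ_eval]
    ring

theorem integral_rpow_mul_sub_rpow {u v X : ℝ} (hu : 0 < u) (hv : 0 < v) (hX : 0 < X) :
    ∫ x in Ioo 0 X, x ^ (u - 1) * (X - x) ^ (v - 1)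
      = X ^ (u + v - 1) * (Gamma u * Gamma v / Gamma (u + v)) := by
  have h := Complex.betaIntegral_scaled u v hX
  rw [Complex.betaIntegral_eq_Gamma_mul_div _ _ (by simpa) (by simpa),
    ← Complex.ofReal_add, Complex.Gamma_ofReal, Complex.Gamma_ofReal, Complex.Gamma_ofReal] at h
  rw [← MeasureTheory.integral_Ioc_eq_integral_Ioo, ← intervalIntegral.integral_of_le hX.le]
  apply Complex.ofReal_injective
  rw [← intervalIntegral.integral_ofReal]
  push_cast
  rw [Complex.ofReal_cpow hX.le]
  push_cast at h ⊢
  rw [← h]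
  refine intervalIntegral.integral_congr fun x hx => ?_
  rw [uIcc_of_le hX.le] at hx
  rw [Complex.ofReal_cpow hx.1, Complex.ofReal_cpow (sub_nonneg.mpr hx.2)]
  push_cast
  rfl

/-- A nonintegrable function has Bochner integral 0, so the positive value of the integral already
proves integrability. -/
theorem integrableOn_rpow_mul_sub_rpow {u v X : ℝ} (hu : 0 < u) (hv : 0 < v) (hX : 0 < X) :
    MeasureTheory.IntegrableOn (fun x => x ^ (u - 1) * (X - x) ^ (v - 1)) (Ioo 0 X) := by
  refine MeasureTheory.Integrable.of_integral_ne_zero ?_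
  rw [integral_rpow_mul_sub_rpow hu hv hX]
  have := Gamma_pos_of_pos hu
  have := Gamma_pos_of_pos hv
  have := Gamma_pos_of_pos (add_pos hu hv)
  positivity

/-- Bateman's fractional integral of a hypergeometric function. -/
theorem integral_hypergeometric_mul_rpow {c v X : ℝ} (a b : ℝ) (hc : 0 < c) (hv : 0 < v)
    (hX : 0 < X) (hX1 : X < 1) :
    ∫ x in Ioo 0 X, ₂F₁ a b c x * (x ^ (c - 1) * (X - x) ^ (v - 1))
      = X ^ (c + v - 1) * (Gamma c * Gamma v / Gamma (c + v)) * ₂F₁ a b (c + v) X := by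
  have hcv : 0 < c + v := add_pos hc hv
  obtain ⟨k, hk⟩ : ∃ k, k = ordinaryHypergeometricCoefficient a b c := ⟨_, rfl⟩
  obtain ⟨l, hl⟩ : ∃ l, l = ordinaryHypergeometricCoefficient a b (c + v) := ⟨_, rfl⟩
  have hcn (n : ℕ) : 0 < c + n := by positivity
  -- Each Beta integral trades (c)_n for (c+v)_n in the denominator, which raises the lower
  -- parameter.
  have hI (n : ℕ) : k n * ∫ x in Ioo 0 X, x ^ (c + n - 1) * (X - x) ^ (v - 1)
      = X ^ (c + v - 1) * (Gamma c * Gamma v / Gamma (c + v)) * (l n * X ^ n) := by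
    rw [integral_rpow_mul_sub_rpow (hcn n) hv hX, Gamma_add_natCast_eq hc,
      show c + n + v = c + v + n by ring, Gamma_add_natCast_eq hcv,
      show c + v + n - 1 = (c + v - 1) + n by ring, rpow_add hX, rpow_natCast, hk, hl]
    have h1 := (ascPochhammer_pos n c hc).ne'
    have h2 := (ascPochhammer_pos n (c + v) hcv).ne'
    have h3 := (Gamma_pos_of_pos hcv).ne'
    have h4 : (n.factorial : ℝ) ≠ 0 := by positivity
    simp only [ordinaryHypergeometricCoefficient]
    field_simp
  have hXa : |X| < 1 := by rwa [abs_of_pos hX]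
  have hnn {n : ℕ} {x : ℝ} (hx : x ∈ Ioo 0 X) : 0 ≤ x ^ (c + n - 1) * (X - x) ^ (v - 1) :=
    mul_nonneg (rpow_nonneg hx.1.le _) (rpow_nonneg (sub_nonneg.mpr hx.2.le) _)
  have hsum : Summable fun n =>
      ∫ x in Ioo 0 X, ‖k n * (x ^ (c + n - 1) * (X - x) ^ (v - 1))‖ := by
    refine ((summable_norm_hypergeometric hcv a b hXa).mul_left
      ‖X ^ (c + v - 1) * (Gamma c * Gamma v / Gamma (c + v))‖).congr fun n => ?_
    rw [← norm_mul, ← hl, ← hI n, norm_mul, Real.norm_of_nonneg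
      (MeasureTheory.setIntegral_nonneg measurableSet_Ioo fun x hx => hnn hx),
      ← MeasureTheory.integral_const_mul]
    refine MeasureTheory.setIntegral_congr_fun measurableSet_Ioo fun x hx => ?_
    rw [norm_mul, Real.norm_of_nonneg (hnn hx)]
  have h := MeasureTheory.hasSum_integral_of_summable_integral_norm
    (μ := MeasureTheory.volume.restrict (Ioo 0 X))
    (F := fun n x => k n * (x ^ (c + n - 1) * (X - x) ^ (v - 1)))
    (fun n => (integrableOn_rpow_mul_sub_rpow (hcn n) hv hX).const_mul _) hsum
  simp only [MeasureTheory.integral_const_mul, hI] at h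
  have h2 := (hasSum_hypergeometric hcv a b hXa).mul_left
    (X ^ (c + v - 1) * (Gamma c * Gamma v / Gamma (c + v)))
  rw [← hl] at h2
  rw [h2.unique h]
  refine MeasureTheory.setIntegral_congr_fun measurableSet_Ioo fun x hx => ?_
  rw [hypergeometric_eq_tsum, ← tsum_mul_right, ← hk]
  refine tsum_congr fun n => ?_
  rw [show c + n - 1 = (c - 1) + n by ring, rpow_add hx.1, rpow_natCast]
  ring

theorem cos_sub_cos_eq_sin_sq_half (φ θ : ℝ) :
    cos φ - cos θ = 2 * (sin (θ / 2) ^ 2 - sin (φ / 2) ^ 2) := by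
  have h (t : ℝ) : cos t = 1 - 2 * sin (t / 2) ^ 2 := by
    have := cos_two_mul (t / 2)
    rw [mul_div_cancel₀ t two_ne_zero, cos_sq'] at this
    linarith
  rw [h φ, h θ]
  ring

theorem one_sub_cos_div_two (θ : ℝ) : (1 - cos θ) / 2 = sin (θ / 2) ^ 2 := by
  have := cos_sub_cos_eq_sin_sq_half 0 θ
  rw [cos_zero, zero_div, sin_zero] at this
  linarith

theorem image_sin_sq_half {θ : ℝ} (hθ : θ ∈ Ioo 0 π) :
    (fun φ => sin (φ / 2) ^ 2) '' Ioo 0 θ = Ioo 0 (sin (θ / 2) ^ 2) := by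
  apply Subset.antisymm
  · rintro _ ⟨φ, hφ, rfl⟩
    have h1 : 0 < sin (φ / 2) :=
      sin_pos_of_pos_of_lt_pi (by linarith [hφ.1]) (by linarith [hφ.2, hθ.2, pi_pos])
    have h2 := cos_lt_cos_of_nonneg_of_le_pi hφ.1.le hθ.2.le hφ.2
    exact ⟨by positivity, by linarith [cos_sub_cos_eq_sin_sq_half φ θ]⟩
  · have := intermediate_value_Ioo (f := fun φ : ℝ => sin (φ / 2) ^ 2) hθ.1.le
      (by fun_prop)
    simpa using this

/-- With x = sin²(φ/2) and X = sin²(θ/2), cos φ - cos θ becomes 2(X - x), and cos(μφ) dφ becomes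
₂F₁(1/2+μ, 1/2-μ; 1/2; x) x^(-1/2) dx. Bateman's integral raises the lower parameter to λ + 1/2, and
Euler's transformation yields the parameters λ ∓ μ. -/
theorem integral_cos_mul_sub_cos_rpow {lam θ : ℝ} (μ : ℝ) (hlam : 0 < lam) (hθ : θ ∈ Ioo 0 π) :
    ∫ φ in Ioo 0 θ, cos (μ * φ) * (cos φ - cos θ) ^ (lam - 1)
      = √π * Gamma lam / (2 ^ lam * Gamma (lam + 1 / 2)) * (sin θ ^ (2 * lam - 1) *
        ₂F₁ (lam - μ) (lam + μ) (lam + 1 / 2) (sin (θ / 2) ^ 2)) := by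
  have hπ : θ ∈ Ioo (-π) π := ⟨by linarith [hθ.1, pi_pos], hθ.2⟩
  have hs : 0 < sin (θ / 2) :=
    sin_pos_of_pos_of_lt_pi (by linarith [hθ.1]) (by linarith [hθ.2, pi_pos])
  have hcθ := cos_half_pos hπ
  have hX : 0 < sin (θ / 2) ^ 2 := by positivity
  have hXa := abs_sin_sq_half_lt_one hπ
  have hX1 : sin (θ / 2) ^ 2 < 1 := (abs_lt.mp hXa).2
  have h := MeasureTheory.integral_image_eq_integral_abs_deriv_smul (s := Ioo 0 θ)
    (f := fun φ => sin (φ / 2) ^ 2) (f' := fun φ => sin (φ / 2) * cos (φ / 2))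
    measurableSet_Ioo (fun φ _ => by
      have := (((hasDerivAt_id φ).div_const 2).sin).pow 2
      refine (this.congr_deriv ?_).hasDerivWithinAt
      simp
      ring) (fun x hx y hy hxy => by
      have h1 := cos_sub_cos_eq_sin_sq_half x y
      simp only at hxy
      rw [hxy, sub_self, mul_zero, sub_eq_zero] at h1
      exact injOn_cos ⟨hx.1.le, (hx.2.trans hθ.2).le⟩ ⟨hy.1.le, (hy.2.trans hθ.2).le⟩ h1)
    (fun x => ₂F₁ (1 / 2 + μ) (1 / 2 - μ) (1 / 2) x *
      (x ^ ((1 / 2 : ℝ) - 1) * (sin (θ / 2) ^ 2 - x) ^ (lam - 1)))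
  rw [image_sin_sq_half hθ, integral_hypergeometric_mul_rpow _ _ (by norm_num) hlam hX hX1] at h
  have e : ∀ φ ∈ Ioo 0 θ, cos (μ * φ) * (cos φ - cos θ) ^ (lam - 1)
      = 2 ^ (lam - 1) * (|sin (φ / 2) * cos (φ / 2)| • (₂F₁ (1 / 2 + μ) (1 / 2 - μ) (1 / 2)
        (sin (φ / 2) ^ 2) * ((sin (φ / 2) ^ 2) ^ ((1 / 2 : ℝ) - 1) *
          (sin (θ / 2) ^ 2 - sin (φ / 2) ^ 2) ^ (lam - 1)))) := by
    intro φ hφ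
    have hφπ : φ ∈ Ioo (-π) π := ⟨by linarith [hφ.1, pi_pos], hφ.2.trans hθ.2⟩
    have h1 : 0 < sin (φ / 2) :=
      sin_pos_of_pos_of_lt_pi (by linarith [hφ.1]) (by linarith [hφ.2, hθ.2, pi_pos])
    have h2 := cos_half_pos hφπ
    have h3 := cos_lt_cos_of_nonneg_of_le_pi hφ.1.le hθ.2.le hφ.2
    have h4 := cos_sub_cos_eq_sin_sq_half φ θ
    rw [h4, mul_rpow (by norm_num) (by linarith), abs_of_pos (mul_pos h1 h2), smul_eq_mul,
      ← cos_half_mul_hypergeometric μ hφπ, ← rpow_two (sin (φ / 2)), ← rpow_mul h1.le,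
      show (2 : ℝ) * (1 / 2 - 1) = -1 by norm_num, rpow_neg_one]
    field_simp
  rw [MeasureTheory.setIntegral_congr_fun measurableSet_Ioo e, MeasureTheory.integral_const_mul,
    ← h, show (1 / 2 : ℝ) + lam = lam + 1 / 2 by ring, Gamma_one_half_eq,
    hypergeometric_euler (by linarith) (1 / 2 + μ) (1 / 2 - μ) hXa, one_sub_sin_sq_half_rpow hπ]
  have hsin : sin θ = 2 * sin (θ / 2) * cos (θ / 2) := by
    rw [← sin_two_mul]; congr 1; ring
  rw [hsin, mul_rpow (by positivity) hcθ.le, mul_rpow (by norm_num) hs.le,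
    ← rpow_two (sin (θ / 2)), ← rpow_mul hs.le,
    show 2 * (lam + 1 / 2 - 1) = 2 * lam - 1 by ring,
    show 2 * (lam + 1 / 2 - (1 / 2 + μ) - (1 / 2 - μ)) = 2 * lam - 1 by ring,
    show lam + 1 / 2 - (1 / 2 + μ) = lam - μ by ring,
    show lam + 1 / 2 - (1 / 2 - μ) = lam + μ by ring,
    show 2 * lam - 1 = lam + (lam - 1) by ring, rpow_add two_pos]
  have := (Gamma_pos_of_pos (show 0 < lam + 1 / 2 by linarith)).ne'
  have := (rpow_pos_of_pos two_pos lam).ne'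
  field_simp

theorem one_le_hypergeometric {a b c x : ℝ} (ha : 0 < a) (hb : 0 < b) (hc : 0 < c) (hx : 0 ≤ x)
    (hx1 : x < 1) : 1 ≤ ₂F₁ a b c x := by
  have h := hasSum_hypergeometric hc a b (by rwa [abs_of_nonneg hx])
  have := h.summable.le_tsum 0 (fun n _ => by
    have h1 := ascPochhammer_pos n a ha
    have h2 := ascPochhammer_pos n b hb
    have h3 := ascPochhammer_pos n c hc
    unfold ordinaryHypergeometricCoefficient
    positivity)
  rwa [h.tsum_eq, hypergeometricCoefficient_zero, pow_zero, one_mul] at this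

/-- At μ = 0 the Mehler–Dirichlet formula gives a positive value, because both upper parameters
equal λ > 0. -/
theorem integrableOn_sub_cos_rpow {lam θ : ℝ} (hlam : 0 < lam) (hθ : θ ∈ Ioo 0 π) :
    MeasureTheory.IntegrableOn (fun φ => (cos φ - cos θ) ^ (lam - 1)) (Ioo 0 θ) := by
  refine MeasureTheory.Integrable.of_integral_ne_zero ?_
  have h := integral_cos_mul_sub_cos_rpow 0 hlam hθ
  simp only [zero_mul, cos_zero, one_mul, sub_zero, add_zero] at h
  rw [h]
  have hπ : θ ∈ Ioo (-π) π := ⟨by linarith [hθ.1, pi_pos], hθ.2⟩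
  have h1 := one_le_hypergeometric (c := lam + 1 / 2) hlam hlam (by linarith)
    (sq_nonneg (sin (θ / 2))) (abs_lt.mp (abs_sin_sq_half_lt_one hπ)).2
  have h2 := Gamma_pos_of_pos hlam
  have h3 := Gamma_pos_of_pos (show 0 < lam + 1 / 2 by linarith)
  have h4 := sin_pos_of_pos_of_lt_pi hθ.1 hθ.2
  have h5 := pi_pos
  positivity

/-! ### The Laplace-type integrand and its integrability -/

theorem integrableOn_rpow_mul_exp_neg {p r : ℝ} (hp : -1 < p) (hr : 0 < r) :
    MeasureTheory.IntegrableOn (fun t => t ^ p * exp (-(r * t))) (Ioi 0) := by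
  refine MeasureTheory.Integrable.of_integral_ne_zero ?_
  have h := integral_rpow_mul_exp_neg_mul_Ioi (a := p + 1) (by linarith) hr
  rw [add_sub_cancel_right] at h
  rw [h]
  have := Gamma_pos_of_pos (show 0 < p + 1 by linarith)
  positivity

theorem le_sinh_of_nonneg {t : ℝ} (ht : 0 ≤ t) : t ≤ sinh t := self_le_sinh_iff.mpr ht

theorem continuous_tanh : Continuous tanh := by
  have : tanh = fun t => sinh t / cosh t := funext tanh_eq_sinh_div_cosh
  rw [this]
  exact continuous_sinh.div continuous_cosh fun t => (cosh_pos t).ne'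

theorem sinh_le_mul_exp (t : ℝ) : sinh t ≤ t * exp t := by
  rw [sinh_eq]
  have h1 := add_one_le_exp (-(2 * t))
  have h2 := exp_pos t
  have h3 : exp (-t) = exp t * exp (-(2 * t)) := by rw [← exp_add]; congr 1; ring
  rw [h3]
  nlinarith

/-- Covers both signs of p at once; the exponent λ - 1 changes sign at λ = 1. -/
theorem rpow_le_rpow_add_rpow {a b x : ℝ} (p : ℝ) (ha : 0 < a) (hax : a ≤ x) (hxb : x ≤ b) :
    x ^ p ≤ a ^ p + b ^ p := by
  have hx : 0 < x := ha.trans_le hax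
  have h1 := rpow_pos_of_pos ha p
  have h2 := rpow_pos_of_pos (hx.trans_le hxb) p
  rcases le_total 0 p with hp | hp
  · linarith [rpow_le_rpow hx.le hxb hp]
  · linarith [rpow_le_rpow_of_nonpos ha hax hp]

/-- The integrand `e^{-μ t} sinh(t)^p (1 + i cot θ tanh(t/2))^p`. -/
noncomputable def gegenbauerIntegrand (p μ θ t : ℝ) : ℂ :=
  ((exp (-(μ * t)) * sinh t ^ p : ℝ) : ℂ)
    * (1 + ((cot θ * tanh (t / 2) : ℝ) : ℂ) * Complex.I) ^ (p : ℂ)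

theorem one_add_mul_I_mem_slitPlane (y : ℝ) : 1 + (y : ℂ) * Complex.I ∈ Complex.slitPlane := by
  left
  simp

theorem one_le_norm_one_add_mul_I (y : ℝ) : 1 ≤ ‖1 + (y : ℂ) * Complex.I‖ := by
  simpa using Complex.re_le_norm (1 + (y : ℂ) * Complex.I)

theorem norm_one_add_mul_I_le (y : ℝ) : ‖1 + (y : ℂ) * Complex.I‖ ≤ 1 + |y| := by
  refine (norm_add_le _ _).trans ?_
  simp

theorem continuousOn_gegenbauerIntegrand (p μ θ : ℝ) :
    ContinuousOn (gegenbauerIntegrand p μ θ) (Ioi 0) := by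
  unfold gegenbauerIntegrand
  refine ContinuousOn.mul ?_ ?_
  · refine Complex.continuous_ofReal.comp_continuousOn (ContinuousOn.mul (by fun_prop) ?_)
    exact continuous_sinh.continuousOn.rpow_const fun t ht =>
      Or.inl (sinh_pos_iff.mpr ht).ne'
  · refine ContinuousOn.cpow ?_ continuousOn_const fun t _ => one_add_mul_I_mem_slitPlane _
    have : Continuous fun t : ℝ => cot θ * tanh (t / 2) :=
      continuous_const.mul (continuous_tanh.comp (continuous_id.div_const 2))
    exact (continuous_const.add
      ((Complex.continuous_ofReal.comp this).mul continuous_const)).continuousOn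

theorem norm_gegenbauerIntegrand_le {p μ θ t : ℝ} (ht : 0 < t) :
    ‖gegenbauerIntegrand p μ θ t‖ ≤ (1 + (1 + |cot θ|) ^ p) *
      (t ^ p * exp (-(μ * t)) + t ^ p * exp (-((μ - p) * t))) := by
  have hs := sinh_pos_iff.mpr ht
  rw [gegenbauerIntegrand, norm_mul, Complex.norm_real, Real.norm_of_nonneg (by positivity),
    Complex.norm_cpow_real, mul_comm]
  refine mul_le_mul ?_ ?_ (by positivity) (by positivity)
  · have h1 := rpow_le_rpow_add_rpow p one_pos (one_le_norm_one_add_mul_I (cot θ * tanh (t / 2)))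
      (b := 1 + |cot θ|) ((norm_one_add_mul_I_le _).trans ?_)
    · rwa [one_rpow] at h1
    · rw [abs_mul]
      have : |tanh (t / 2)| ≤ 1 := (abs_tanh_lt_one _).le
      have := mul_le_mul_of_nonneg_left this (abs_nonneg (cot θ))
      linarith
  · have h1 := rpow_le_rpow_add_rpow p ht (le_sinh_of_nonneg ht.le) (sinh_le_mul_exp t)
    rw [mul_rpow ht.le (exp_pos t).le, ← exp_mul] at h1
    calc exp (-(μ * t)) * sinh t ^ p
        ≤ exp (-(μ * t)) * (t ^ p + t ^ p * exp (t * p)) := by gcongr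
      _ = _ := by
        rw [show -((μ - p) * t) = -(μ * t) + t * p by ring, exp_add]
        ring

theorem integrableOn_gegenbauerIntegrand {p μ : ℝ} (θ : ℝ) (hp : -1 < p) (hμ : 0 < μ)
    (hμp : p < μ) : MeasureTheory.IntegrableOn (gegenbauerIntegrand p μ θ) (Ioi 0) := by
  refine MeasureTheory.Integrable.mono' (((integrableOn_rpow_mul_exp_neg hp hμ).add
    (integrableOn_rpow_mul_exp_neg hp (sub_pos.mpr hμp))).const_mul (1 + (1 + |cot θ|) ^ p))
    ((continuousOn_gegenbauerIntegrand p μ θ).aestronglyMeasurable measurableSet_Ioi) ?_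
  filter_upwards [MeasureTheory.ae_restrict_mem measurableSet_Ioi] with t ht
  exact norm_gegenbauerIntegrand_le ht

/-! ### Contour shift from [0, θ] to the vertical ray above θ -/

/-- The function `e^{iμz} (cos z - cos θ)^p`. -/
noncomputable def mehlerIntegrand (p μ θ : ℝ) (z : ℂ) : ℂ :=
  Complex.exp (μ * z * Complex.I) * (Complex.cos z - cos θ) ^ (p : ℂ)

theorem cos_add_mul_I_sub (x t θ : ℝ) :
    Complex.cos (x + t * Complex.I) - cos θ
      = ((cos x * cosh t - cos θ : ℝ) : ℂ) + ((-(sin x * sinh t) : ℝ) : ℂ) * Complex.I := by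
  rw [Complex.cos_add_mul_I]
  push_cast
  ring

/-- For x > 0 the imaginary part -sin x sinh t is negative; at x = 0 the real part cosh t - cos θ is
positive. The principal power is thus holomorphic near every point of the strip. -/
theorem cos_add_mul_I_sub_mem_slitPlane {x t θ : ℝ} (hθ : θ ∈ Ioo 0 π) (hx : x ∈ Icc 0 θ)
    (ht : 0 < t) : Complex.cos (x + t * Complex.I) - cos θ ∈ Complex.slitPlane := by
  rw [cos_add_mul_I_sub]
  rcases hx.1.eq_or_lt with rfl | hx0
  · left
    simp only [Complex.add_re, Complex.ofReal_re, Complex.re_ofReal_mul, Complex.I_re, mul_zero,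
      add_zero, cos_zero, one_mul]
    linarith [one_lt_cosh.mpr ht.ne', cos_le_one θ]
  · right
    simp only [Complex.add_im, Complex.ofReal_im, Complex.im_ofReal_mul, Complex.I_im, mul_one,
      zero_add]
    have h1 := sin_pos_of_pos_of_lt_pi hx0 (hx.2.trans_lt hθ.2)
    have h2 := sinh_pos_iff.mpr ht
    exact (neg_neg_of_pos (mul_pos h1 h2)).ne

/-- Since |cos x cos θ| ≤ 1, both summands are nonnegative; the lower and upper bounds for the norm
follow from this form. -/
theorem sq_norm_cos_add_mul_I_sub (x t θ : ℝ) :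
    ‖Complex.cos (x + t * Complex.I) - cos θ‖ ^ 2
      = (cos x - cos θ) ^ 2 + (cosh t - 1) * (cosh t + 1 - 2 * (cos x * cos θ)) := by
  rw [cos_add_mul_I_sub, ← Complex.normSq_eq_norm_sq, Complex.normSq_add_mul_I]
  have h1 := sin_sq x
  have h2 := sinh_sq t
  linear_combination sinh t ^ 2 * h1 + (1 - cos x ^ 2) * h2

theorem abs_cos_mul_cos_le_one (x θ : ℝ) : |cos x * cos θ| ≤ 1 := by
  rw [abs_mul]
  exact mul_le_one₀ (abs_cos_le_one x) (abs_nonneg _) (abs_cos_le_one θ)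

theorem abs_cos_sub_cos_le_norm (x t θ : ℝ) :
    |cos x - cos θ| ≤ ‖Complex.cos (x + t * Complex.I) - cos θ‖ := by
  have h := abs_le.mp (abs_cos_mul_cos_le_one x θ)
  have h1 := one_le_cosh t
  refine abs_le_of_sq_le_sq ?_ (norm_nonneg _)
  rw [sq_norm_cos_add_mul_I_sub]
  nlinarith

theorem cosh_sub_one_le_norm (x t θ : ℝ) :
    cosh t - 1 ≤ ‖Complex.cos (x + t * Complex.I) - cos θ‖ := by
  have h := abs_le.mp (abs_cos_mul_cos_le_one x θ)
  have h1 := one_le_cosh t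
  refine (abs_le_of_sq_le_sq' ?_ (norm_nonneg _)).2
  rw [sq_norm_cos_add_mul_I_sub]
  nlinarith [sq_nonneg (cos x - cos θ)]

theorem norm_cos_add_mul_I_sub_le (x t θ : ℝ) :
    ‖Complex.cos (x + t * Complex.I) - cos θ‖ ≤ cosh t + 1 := by
  have h := abs_le.mp (abs_cos_mul_cos_le_one x θ)
  have h1 := one_le_cosh t
  refine (abs_le_of_sq_le_sq' ?_ (by linarith)).2
  rw [sq_norm_cos_add_mul_I_sub]
  nlinarith [cos_sq_le_one x, cos_sq_le_one θ]

theorem differentiableAt_mehlerIntegrand {p μ θ : ℝ} {z : ℂ}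
    (hz : Complex.cos z - cos θ ∈ Complex.slitPlane) :
    DifferentiableAt ℂ (mehlerIntegrand p μ θ) z := by
  unfold mehlerIntegrand
  have h1 : DifferentiableAt ℂ (fun z => Complex.cos z - cos θ) z := by fun_prop
  have h2 : DifferentiableAt ℂ (fun z : ℂ => Complex.exp (μ * z * Complex.I)) z := by fun_prop
  exact h2.mul (h1.cpow_const hz)

theorem norm_mehlerIntegrand (p μ θ x t : ℝ) :
    ‖mehlerIntegrand p μ θ (x + t * Complex.I)‖
      = exp (-(μ * t)) * ‖Complex.cos (x + t * Complex.I) - cos θ‖ ^ p := by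
  rw [mehlerIntegrand, norm_mul, Complex.norm_cpow_real, Complex.norm_exp]
  congr 2
  simp

theorem mehlerIntegrand_ofReal {p μ θ x : ℝ} (hx : cos θ ≤ cos x) :
    (mehlerIntegrand p μ θ x).re = cos (μ * x) * (cos x - cos θ) ^ p := by
  rw [mehlerIntegrand, ← Complex.ofReal_cos, ← Complex.ofReal_sub,
    ← Complex.ofReal_cpow (sub_nonneg.mpr hx), Complex.re_mul_ofReal, ← Complex.ofReal_mul,
    Complex.exp_ofReal_mul_I_re]

theorem mehlerIntegrand_mul_I_im {p μ θ t : ℝ} :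
    (mehlerIntegrand p μ θ (t * Complex.I)).im = 0 := by
  have h1 : (0 : ℝ) ≤ cosh t - cos θ := by linarith [one_le_cosh t, cos_le_one θ]
  have e : (μ : ℂ) * (t * Complex.I) * Complex.I = ((-(μ * t) : ℝ) : ℂ) := by
    push_cast
    linear_combination (μ * t : ℂ) * Complex.I_mul_I
  rw [mehlerIntegrand, Complex.cos_mul_I, ← Complex.ofReal_cosh, ← Complex.ofReal_sub,
    ← Complex.ofReal_cpow h1, e, ← Complex.ofReal_exp, ← Complex.ofReal_mul, Complex.ofReal_im]

theorem cosh_sub_one_eq_sinh_mul_tanh_half (t : ℝ) : cosh t - 1 = sinh t * tanh (t / 2) := by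
  have h1 := cosh_two_mul (t / 2)
  have h2 := sinh_two_mul (t / 2)
  rw [mul_div_cancel₀ t two_ne_zero] at h1 h2
  rw [tanh_eq_sinh_div_cosh, h1, h2]
  have := (cosh_pos (t / 2)).ne'
  have h3 := cosh_sq (t / 2)
  field_simp
  linarith

/-- The argument of w lies in (-π/2, π/2), so subtracting π/2 does not cross the cut. -/
theorem neg_I_mul_cpow {w : ℂ} (hw : 0 < w.re) (p : ℂ) :
    (-Complex.I * w) ^ p = Complex.exp (-(π / 2) * Complex.I * p) * w ^ p := by
  have hw0 : w ≠ 0 := by rintro rfl; simp at hw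
  have hI : -Complex.I ≠ 0 := neg_ne_zero.mpr Complex.I_ne_zero
  have harg := abs_lt.mp (Complex.abs_arg_lt_pi_div_two_iff.mpr (Or.inl hw))
  rw [Complex.cpow_def_of_ne_zero (mul_ne_zero hI hw0), Complex.cpow_def_of_ne_zero hw0,
    Complex.log_mul hI hw0 ?_, Complex.log_neg_I, add_mul, Complex.exp_add]
  rw [Complex.arg_neg_I]
  constructor <;> linarith [harg.1, harg.2, pi_pos]

theorem ofReal_mul_cpow {r : ℝ} (hr : 0 < r) {w : ℂ} (hw : w ≠ 0) (p : ℝ) :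
    ((r : ℂ) * w) ^ (p : ℂ) = ((r ^ p : ℝ) : ℂ) * w ^ (p : ℂ) := by
  have hr0 : (r : ℂ) ≠ 0 := Complex.ofReal_ne_zero.mpr hr.ne'
  rw [Complex.ofReal_cpow hr.le, Complex.cpow_def_of_ne_zero (mul_ne_zero hr0 hw),
    Complex.cpow_def_of_ne_zero hw, Complex.cpow_def_of_ne_zero hr0, Complex.log_ofReal_mul hr hw,
    add_mul, Complex.exp_add, Complex.ofReal_log hr.le]

/-- On the ray, cos z - cos θ = -i sin θ sinh t (1 + i cot θ tanh(t/2)), because cosh t - 1 = sinh t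
tanh(t/2). The power of -i and the factor i of dz together give the phase -(p+1)π/2. -/
theorem I_mul_mehlerIntegrand {p μ θ t : ℝ} (hθ : θ ∈ Ioo 0 π) (ht : 0 < t) :
    Complex.I * mehlerIntegrand p μ θ (θ + t * Complex.I)
      = -((sin θ ^ p : ℝ) * (Complex.exp ((μ * θ - (p + 1) * π / 2 : ℝ) * Complex.I)
        * gegenbauerIntegrand p μ θ t)) := by
  have hs := sin_pos_of_pos_of_lt_pi hθ.1 hθ.2
  have hsh := sinh_pos_iff.mpr ht
  set w : ℂ := 1 + ((cot θ * tanh (t / 2) : ℝ) : ℂ) * Complex.I with hw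
  have hwre : 0 < w.re := by
    rw [hw, Complex.add_re, Complex.one_re, Complex.re_ofReal_mul, Complex.I_re, mul_zero, add_zero]
    exact one_pos
  have hw0 : w ≠ 0 := by intro h; simp [h] at hwre
  have e1 : Complex.cos (θ + t * Complex.I) - cos θ
      = ((sin θ * sinh t : ℝ) : ℂ) * (-Complex.I * w) := by
    have h1 : sin θ * sinh t * (cot θ * tanh (t / 2)) = cos θ * cosh t - cos θ := by
      rw [cot_eq_cos_div_sin]
      have := cosh_sub_one_eq_sinh_mul_tanh_half t
      field_simp
      linear_combination -cos θ * this
    rw [cos_add_mul_I_sub, ← h1, hw]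
    generalize cot θ * tanh (t / 2) = y
    simp only [Complex.ofReal_mul, Complex.ofReal_neg]
    linear_combination (((sin θ : ℝ) : ℂ) * ((sinh t : ℝ) : ℂ) * (y : ℂ)) * Complex.I_mul_I
  have e2 : Complex.I * (Complex.exp (μ * (θ + t * Complex.I) * Complex.I)
      * Complex.exp (-(π / 2) * Complex.I * p))
      = -(Complex.exp ((μ * θ - (p + 1) * π / 2 : ℝ) * Complex.I)
        * ((exp (-(μ * t)) : ℝ) : ℂ)) := by
    have hI : Complex.I = -Complex.exp (-(π / 2) * Complex.I) := by
      rw [← neg_div, Complex.exp_neg_pi_div_two_mul_I, neg_neg]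
    conv_lhs => enter [1]; rw [hI]
    rw [neg_mul, ← Complex.exp_add, ← Complex.exp_add, Complex.ofReal_exp, ← Complex.exp_add]
    congr 2
    push_cast
    linear_combination (μ * t : ℂ) * Complex.I_mul_I
  rw [mehlerIntegrand, e1, ofReal_mul_cpow (mul_pos hs hsh)
    (mul_ne_zero (neg_ne_zero.mpr Complex.I_ne_zero) hw0), neg_I_mul_cpow hwre,
    mul_rpow hs.le hsh.le, gegenbauerIntegrand, ← hw]
  push_cast at e2 ⊢
  linear_combination ((sin θ ^ p : ℝ) : ℂ) * ((sinh t ^ p : ℝ) : ℂ) * w ^ (p : ℂ) * e2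

/-- Cauchy's theorem on [0, θ] × [ε, T], lifted by ε to avoid the branch point θ. The integrand is
real on the left edge, so that edge, carrying a factor i, drops out of the real part. -/
theorem mehlerIntegrand_rectangle {p μ θ ε T : ℝ} (hθ : θ ∈ Ioo 0 π) (hε : 0 < ε) (hT : ε ≤ T) :
    (∫ x in (0 : ℝ)..θ, mehlerIntegrand p μ θ (x + ε * Complex.I)).re
      = (∫ x in (0 : ℝ)..θ, mehlerIntegrand p μ θ (x + T * Complex.I)).re
        + sin θ ^ p * (Complex.exp ((μ * θ - (p + 1) * π / 2 : ℝ) * Complex.I)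
          * ∫ t in ε..T, gegenbauerIntegrand p μ θ t).re := by
  have h := Complex.integral_boundary_rect_eq_zero_of_differentiableOn (mehlerIntegrand p μ θ)
    (ε * Complex.I) (θ + T * Complex.I) (fun z hz => by
      simp only [Complex.mem_reProdIm, Complex.re_ofReal_mul, Complex.I_re, mul_zero,
        Complex.add_re, Complex.ofReal_re, add_zero, Complex.im_ofReal_mul, Complex.I_im, mul_one,
        Complex.add_im, Complex.ofReal_im, zero_add, uIcc_of_le hθ.1.le, uIcc_of_le hT] at hz
      refine (differentiableAt_mehlerIntegrand ?_).differentiableWithinAt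
      rw [← Complex.re_add_im z]
      exact cos_add_mul_I_sub_mem_slitPlane hθ hz.1 (hε.trans_le hz.2.1))
  simp only [Complex.re_ofReal_mul, Complex.I_re, mul_zero,
        Complex.add_re, Complex.ofReal_re, add_zero, Complex.im_ofReal_mul, Complex.I_im, mul_one,
        Complex.add_im, Complex.ofReal_im, zero_add, smul_eq_mul, Complex.ofReal_zero] at h
  have h1 : Complex.I * ∫ y in ε..T, mehlerIntegrand p μ θ (θ + y * Complex.I)
      = -((sin θ ^ p : ℝ) * (Complex.exp ((μ * θ - (p + 1) * π / 2 : ℝ) * Complex.I)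
        * ∫ t in ε..T, gegenbauerIntegrand p μ θ t)) := by
    rw [← intervalIntegral.integral_const_mul, ← intervalIntegral.integral_const_mul,
      ← intervalIntegral.integral_const_mul, ← intervalIntegral.integral_neg]
    refine intervalIntegral.integral_congr fun t ht => ?_
    rw [uIcc_of_le hT] at ht
    exact I_mul_mehlerIntegrand hθ (hε.trans_le ht.1)
  have h2 : (∫ y in ε..T, mehlerIntegrand p μ θ (y * Complex.I)).im = 0 := by
    have e : ∀ y : ℝ, mehlerIntegrand p μ θ (y * Complex.I)
        = (((mehlerIntegrand p μ θ (y * Complex.I)).re : ℝ) : ℂ) := fun y =>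
      Complex.ext rfl (by rw [Complex.ofReal_im, mehlerIntegrand_mul_I_im])
    rw [intervalIntegral.integral_congr fun y _ => e y, intervalIntegral.integral_ofReal,
      Complex.ofReal_im]
  rw [h1] at h
  have h3 := congrArg Complex.re h
  rw [Complex.sub_re, Complex.add_re, Complex.sub_re, Complex.I_mul_re, h2, Complex.neg_re,
    Complex.re_ofReal_mul, Complex.zero_re] at h3
  linarith

open Filter Topology MeasureTheory in
theorem tendsto_integral_mehlerIntegrand_bottom {p μ θ : ℝ} (hp : -1 < p) (hμ : 0 < μ)
    (hθ : θ ∈ Ioo 0 π) {ε : ℕ → ℝ} (hε : ∀ n, ε n ∈ Ioc (0 : ℝ) 1) (hε0 : Tendsto ε atTop (𝓝 0)) :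
    Tendsto (fun n => ∫ x in (0 : ℝ)..θ, mehlerIntegrand p μ θ (x + ε n * Complex.I)) atTop
      (𝓝 (∫ x in (0 : ℝ)..θ, mehlerIntegrand p μ θ x)) := by
  have hlt {x : ℝ} (hx : x ∈ Ioc 0 θ) (hxθ : x ≠ θ) : 0 < cos x - cos θ :=
    sub_pos.mpr (cos_lt_cos_of_nonneg_of_le_pi hx.1.le hθ.2.le (lt_of_le_of_ne hx.2 hxθ))
  have hne : ∀ᵐ x : ℝ, x ≠ θ := compl_mem_ae_iff.mpr (measure_singleton θ)
  -- The base has norm between cos x - cos θ and cosh 1 + 1, so the sum of the two powers dominates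
  -- for either sign of p.
  refine intervalIntegral.tendsto_integral_filter_of_dominated_convergence
    (fun x => (cos x - cos θ) ^ p + (cosh 1 + 1) ^ p) ?_ ?_ ?_ ?_
  · refine Eventually.of_forall fun n => ?_
    rw [uIoc_of_le hθ.1.le]
    refine ContinuousOn.aestronglyMeasurable (fun x hx => ?_) measurableSet_Ioc
    have h1 : ContinuousAt (fun x : ℝ => (x + ε n * Complex.I : ℂ)) x := by fun_prop
    have h2 : ContinuousAt (mehlerIntegrand p μ θ) (x + ε n * Complex.I) :=
      (differentiableAt_mehlerIntegrand
        (cos_add_mul_I_sub_mem_slitPlane hθ ⟨hx.1.le, hx.2⟩ (hε n).1)).continuousAt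
    exact (ContinuousAt.comp (f := fun x : ℝ => (x + ε n * Complex.I : ℂ)) h2
      h1).continuousWithinAt
  · refine Eventually.of_forall fun n => ?_
    filter_upwards [hne] with x hxθ hx
    rw [uIoc_of_le hθ.1.le] at hx
    have h0 := hlt hx hxθ
    have h1 := abs_cos_sub_cos_le_norm x (ε n) θ
    rw [abs_of_pos h0] at h1
    have h2 : ‖Complex.cos (x + ε n * Complex.I) - cos θ‖ ≤ cosh 1 + 1 := by
      refine (norm_cos_add_mul_I_sub_le x (ε n) θ).trans ?_
      have : cosh (ε n) ≤ cosh 1 := by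
        rw [cosh_le_cosh, abs_of_pos (hε n).1, abs_one]
        exact (hε n).2
      linarith
    rw [norm_mehlerIntegrand]
    have h3 : exp (-(μ * ε n)) ≤ 1 := by
      rw [exp_le_one_iff]
      linarith [mul_pos hμ (hε n).1]
    exact (mul_le_of_le_one_left (by positivity) h3).trans (rpow_le_rpow_add_rpow p h0 h1 h2)
  · refine IntervalIntegrable.add ?_ intervalIntegrable_const
    rw [intervalIntegrable_iff_integrableOn_Ioo_of_le hθ.1.le]
    have := integrableOn_sub_cos_rpow (lam := p + 1) (by linarith) hθ
    simpa using this
  · filter_upwards [hne] with x hxθ hx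
    rw [uIoc_of_le hθ.1.le] at hx
    have h1 : ContinuousAt (mehlerIntegrand p μ θ) x :=
      (differentiableAt_mehlerIntegrand (by
        left
        rw [← Complex.ofReal_cos, ← Complex.ofReal_sub, Complex.ofReal_re]
        exact hlt hx hxθ)).continuousAt
    refine h1.tendsto.comp ?_
    have h2 : Tendsto (fun n => (x + ε n * Complex.I : ℂ)) atTop (𝓝 (x + (0 : ℝ) * Complex.I)) :=
      (((Complex.continuous_ofReal.tendsto 0).comp hε0).mul_const _).const_add _
    simpa using h2

open Filter Topology MeasureTheory in
theorem tendsto_integral_mehlerIntegrand_top {p μ : ℝ} (θ : ℝ) (hμ : 0 < μ) (hμp : p < μ)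
    {T : ℕ → ℝ} (hT : Tendsto T atTop atTop) :
    Tendsto (fun n => ∫ x in (0 : ℝ)..θ, mehlerIntegrand p μ θ (x + T n * Complex.I)) atTop
      (𝓝 0) := by
  have hlim : Tendsto (fun n => (exp (-(μ * T n)) + 2 ^ p * exp (-((μ - p) * T n))) * |θ - 0|) atTop
      (𝓝 ((0 + 2 ^ p * 0) * |θ - 0|)) := by
    have h {r : ℝ} (hr : 0 < r) : Tendsto (fun n => exp (-(r * T n))) atTop (𝓝 0) :=
      tendsto_exp_neg_atTop_nhds_zero.comp (hT.const_mul_atTop hr)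
    exact ((h hμ).add ((h (sub_pos.mpr hμp)).const_mul _)).mul_const _
  rw [mul_zero, add_zero, zero_mul] at hlim
  refine squeeze_zero_norm' ?_ hlim
  filter_upwards [hT.eventually_ge_atTop 2] with n hn
  refine intervalIntegral.norm_integral_le_of_norm_le_const fun x _ => ?_
  rw [norm_mehlerIntegrand]
  have h1 : (1 : ℝ) ≤ cosh (T n) - 1 := by
    have := quadratic_le_exp_of_nonneg (by linarith : 0 ≤ T n)
    rw [cosh_eq]
    nlinarith [exp_pos (-T n)]
  have h2 : cosh (T n) + 1 ≤ 2 * exp (T n) := by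
    have h3 : exp (-T n) ≤ exp (T n) := exp_le_exp.mpr (by linarith)
    have h4 : 1 ≤ exp (T n) := one_le_exp (by linarith)
    rw [cosh_eq]
    linarith
  have h3 := rpow_le_rpow_add_rpow p one_pos (h1.trans (cosh_sub_one_le_norm x (T n) θ))
    ((norm_cos_add_mul_I_sub_le x (T n) θ).trans h2)
  rw [one_rpow, mul_rpow two_pos.le (exp_pos _).le, ← exp_mul] at h3
  calc _ ≤ exp (-(μ * T n)) * (1 + 2 ^ p * exp (T n * p)) := by gcongr
    _ = _ := by
      rw [show -((μ - p) * T n) = -(μ * T n) + T n * p by ring, exp_add]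
      ring

open Filter Topology MeasureTheory in
theorem integral_cos_mul_sub_cos_rpow_eq_laplace {p μ θ : ℝ} (hp : -1 < p) (hμ : 0 < μ)
    (hμp : p < μ) (hθ : θ ∈ Ioo 0 π) :
    ∫ φ in Ioo 0 θ, cos (μ * φ) * (cos φ - cos θ) ^ p
      = sin θ ^ p * (Complex.exp ((μ * θ - (p + 1) * π / 2 : ℝ) * Complex.I)
          * ∫ t in Ioi 0, gegenbauerIntegrand p μ θ t).re := by
  have hW := integrableOn_gegenbauerIntegrand θ hp hμ hμp
  set ε : ℕ → ℝ := fun n => 1 / ((n : ℝ) + 1) with hε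
  set T : ℕ → ℝ := fun n => (n : ℝ) + 1 with hT
  have hεT : ∀ n, ε n ≤ T n := fun n => by
    have h1 : (1 : ℝ) ≤ n + 1 := by linarith [n.cast_nonneg (α := ℝ)]
    exact (div_le_one_of_le₀ h1 (by positivity)).trans h1
  have hε1 : ∀ n, ε n ∈ Ioc (0 : ℝ) 1 := fun n => by
    have h1 : (1 : ℝ) ≤ n + 1 := by linarith [n.cast_nonneg (α := ℝ)]
    exact ⟨by positivity, div_le_one_of_le₀ h1 (by positivity)⟩
  have hε0 : Tendsto ε atTop (𝓝 0) := tendsto_one_div_add_atTop_nhds_zero_nat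
  have hTt : Tendsto T atTop atTop := tendsto_atTop_add_const_right _ _ tendsto_natCast_atTop_atTop
  have hWlim : Tendsto (fun n => ∫ t in ε n..T n, gegenbauerIntegrand p μ θ t) atTop
      (𝓝 (∫ t in Ioi 0, gegenbauerIntegrand p μ θ t)) := by
    have hcov : AECover (volume.restrict (Ioi (0 : ℝ))) atTop fun n => Ioi (ε n) ∩ Iic (T n) :=
      (aecover_Ioi_of_Ioi hε0).inter (aecover_Iic hTt)
    refine (hcov.integral_tendsto_of_countably_generated hW).congr fun n => ?_
    rw [intervalIntegral.integral_of_le (hεT n), Measure.restrict_restrict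
      (measurableSet_Ioi.inter measurableSet_Iic), Ioi_inter_Iic, inter_eq_left.mpr]
    exact fun t ht => (hε1 n).1.trans ht.1
  have h1 := (Complex.continuous_re.tendsto _).comp
    (tendsto_integral_mehlerIntegrand_bottom hp hμ hθ hε1 hε0)
  have h2 := ((Complex.continuous_re.tendsto _).comp
    (tendsto_integral_mehlerIntegrand_top θ hμ hμp hTt)).add
    (((Complex.continuous_re.tendsto _).comp (hWlim.const_mul
      (Complex.exp ((μ * θ - (p + 1) * π / 2 : ℝ) * Complex.I)))).const_mul (sin θ ^ p))
  have h3 := tendsto_nhds_unique (h1.congr fun n =>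
    mehlerIntegrand_rectangle hθ (hε1 n).1 (hεT n)) h2
  rw [Complex.zero_re, zero_add] at h3
  rw [← h3, intervalIntegral.integral_of_le hθ.1.le, integral_Ioc_eq_integral_Ioo]
  have hle : ∀ x ∈ Ioo 0 θ, cos θ ≤ cos x := fun x hx =>
    cos_le_cos_of_nonneg_of_le_pi hx.1.le hθ.2.le hx.2.le
  have hint : IntegrableOn (fun x : ℝ => mehlerIntegrand p μ θ x) (Ioo 0 θ) := by
    have h4 := integrableOn_sub_cos_rpow (lam := p + 1) (by linarith) hθ
    rw [add_sub_cancel_right] at h4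
    refine Integrable.mono' h4 (ContinuousOn.aestronglyMeasurable (fun x hx => ?_)
      measurableSet_Ioo) ?_
    · have h5 : ContinuousAt (mehlerIntegrand p μ θ) x :=
        (differentiableAt_mehlerIntegrand (by
          left
          rw [← Complex.ofReal_cos, ← Complex.ofReal_sub, Complex.ofReal_re]
          exact sub_pos.mpr (cos_lt_cos_of_nonneg_of_le_pi hx.1.le hθ.2.le hx.2))).continuousAt
      exact (ContinuousAt.comp (f := fun x : ℝ => (x : ℂ)) h5
        Complex.continuous_ofReal.continuousAt).continuousWithinAt
    · filter_upwards [ae_restrict_mem measurableSet_Ioo] with x hx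
      have := norm_mehlerIntegrand p μ θ x 0
      simp only [Complex.ofReal_zero, zero_mul, add_zero, mul_zero, neg_zero, exp_zero,
        one_mul] at this
      rw [this, ← Complex.ofReal_cos, ← Complex.ofReal_sub, Complex.norm_real,
        Real.norm_of_nonneg (sub_nonneg.mpr (hle x hx))]
  have h6 := integral_re (𝕜 := ℂ) hint
  simp only [RCLike.re_eq_complex_re] at h6
  rw [← h6]
  exact setIntegral_congr_fun measurableSet_Ioo fun x hx => (mehlerIntegrand_ofReal (hle x hx)).symm

/-- The Laplace-type integral representation of the generalized Gegenbauer function. -/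
theorem sin_rpow_mul_rightGGF {lam ν θ : ℝ} (hlam : 0 < lam) (hν : 0 < ν) (hθ : θ ∈ Ioo 0 π) :
    sin θ ^ lam * rightGGF lam ν (cos θ)
      = 2 ^ lam * Gamma (lam + 1 / 2) / (√π * Gamma lam) *
        (Complex.exp (((ν + lam) * θ - lam * π / 2 : ℝ) * Complex.I)
          * ∫ t in Ioi 0, gegenbauerIntegrand (lam - 1) (ν + lam) θ t).re := by
  have h1 := integral_cos_mul_sub_cos_rpow (ν + lam) hlam hθ
  rw [integral_cos_mul_sub_cos_rpow_eq_laplace (by linarith) (by linarith) (by linarith) hθ,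
    sub_add_cancel, show lam - (ν + lam) = -ν by ring, show lam + (ν + lam) = ν + 2 * lam by ring]
    at h1
  have hs := sin_pos_of_pos_of_lt_pi hθ.1 hθ.2
  rw [rightGGF, one_sub_cos_div_two]
  rw [show 2 * lam - 1 = (lam - 1) + lam by ring, rpow_add hs] at h1
  have h2 := (rpow_pos_of_pos hs (lam - 1)).ne'
  have h3 := (Gamma_pos_of_pos hlam).ne'
  have h4 := (Gamma_pos_of_pos (show 0 < lam + 1 / 2 by linarith)).ne'
  have h5 := (rpow_pos_of_pos two_pos lam).ne'
  have h6 : √π ≠ 0 := (sqrt_pos.mpr pi_pos).ne'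
  rw [div_mul_eq_mul_div, eq_div_iff (by positivity)]
  apply mul_left_cancel₀ h2
  rw [div_mul_eq_mul_div, eq_div_iff (by positivity)] at h1
  linear_combination -h1

/-! ### Pointwise comparison of the integrand with its leading part -/

theorem sinh_le_mul_cosh {t : ℝ} (ht : 0 ≤ t) : sinh t ≤ t * cosh t := by
  have hd (x : ℝ) : HasDerivAt (fun t => t * cosh t - sinh t) (x * sinh x) x :=
    (((hasDerivAt_id x).mul (hasDerivAt_cosh x)).sub (hasDerivAt_sinh x)).congr_deriv (by simp)
  have hmono : MonotoneOn (fun t => t * cosh t - sinh t) (Ici 0) := by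
    refine monotoneOn_of_deriv_nonneg (convex_Ici 0)
      (fun x _ => (hd x).continuousAt.continuousWithinAt)
      (fun x _ => (hd x).differentiableAt.differentiableWithinAt) fun x hx => ?_
    rw [(hd x).deriv]
    rw [interior_Ici] at hx
    exact mul_nonneg (le_of_lt hx) (sinh_nonneg_iff.mpr (le_of_lt hx))
  have := hmono self_mem_Ici ht ht
  simp only [zero_mul, sinh_zero, sub_zero] at this
  linarith

theorem tanh_le_self {t : ℝ} (ht : 0 ≤ t) : tanh t ≤ t := by
  rw [tanh_eq_sinh_div_cosh, div_le_iff₀ (cosh_pos t)]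
  exact sinh_le_mul_cosh ht

theorem tanh_nonneg_of_nonneg {t : ℝ} (ht : 0 ≤ t) : 0 ≤ tanh t := by
  rw [tanh_eq_sinh_div_cosh]
  exact div_nonneg (sinh_nonneg_iff.mpr ht) (cosh_pos t).le

/-- The chain sinh t - t ≤ t(cosh t - 1) = 2t sinh²(t/2) ≤ t³eᵗ/2 is stronger; 2/3 is the constant
of the final bound. -/
theorem sinh_sub_self_le {t : ℝ} (ht : 0 ≤ t) : sinh t - t ≤ 2 / 3 * t ^ 3 * exp t := by
  have h1 := sinh_le_mul_cosh ht
  have h2 : cosh t = 1 + 2 * sinh (t / 2) ^ 2 := by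
    have h := cosh_two_mul (t / 2)
    rw [mul_div_cancel₀ t two_ne_zero, cosh_sq] at h
    linarith
  have h3 := sinh_le_mul_exp (t / 2)
  have h4 : 0 ≤ sinh (t / 2) := sinh_nonneg_iff.mpr (by linarith)
  have h5 : exp (t / 2) ^ 2 = exp t := by rw [← exp_nat_mul]; congr 1; push_cast; ring
  have h6 : sinh (t / 2) ^ 2 ≤ (t / 2 * exp (t / 2)) ^ 2 := pow_le_pow_left₀ h4 h3 2
  rw [mul_pow, h5] at h6
  have h7 : 0 ≤ t ^ 3 * exp t := by positivity
  have h8 := mul_le_mul_of_nonneg_left h6 ht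
  rw [h2] at h1
  nlinarith

/-- The mean value inequality for s ↦ (1 + sw)^p on [0, 1]; Re w ≥ 0 keeps the segment off the cut.
-/
theorem norm_one_add_cpow_sub_one_le {p M : ℝ} {w : ℂ} (hw : 0 ≤ w.re)
    (hM : ∀ s ∈ Icc (0 : ℝ) 1, ‖1 + (s : ℂ) * w‖ ^ (p - 1) ≤ M) :
    ‖(1 + w) ^ (p : ℂ) - 1‖ ≤ |p| * ‖w‖ * M := by
  have hre (s : ℝ) (hs : s ∈ Icc (0 : ℝ) 1) : 0 < (1 + (s : ℂ) * w).re := by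
    rw [Complex.add_re, Complex.one_re, Complex.re_ofReal_mul]
    linarith [mul_nonneg hs.1 hw]
  have h := norm_image_sub_le_of_norm_deriv_le_segment_01'
    (f := fun s : ℝ => (1 + (s : ℂ) * w) ^ (p : ℂ))
    (f' := fun s : ℝ => p * (1 + (s : ℂ) * w) ^ ((p : ℂ) - 1) * w) (C := |p| * ‖w‖ * M)
    (fun s hs => by
      have h1 : HasDerivAt (fun z : ℂ => (1 + z * w) ^ (p : ℂ))
          (p * (1 + (s : ℂ) * w) ^ ((p : ℂ) - 1) * w) s := by
        have h2 : HasDerivAt (fun z : ℂ => 1 + z * w) w (s : ℂ) := by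
          simpa using ((hasDerivAt_id (s : ℂ)).mul_const w).const_add 1
        exact h2.cpow_const (Or.inl (hre s hs))
      exact h1.comp_ofReal.hasDerivWithinAt)
    (fun s hs => by
      have h3 := hM s (Ico_subset_Icc_self hs)
      rw [norm_mul, norm_mul, Complex.norm_real, Real.norm_eq_abs,
        show ((p : ℂ) - 1) = ((p - 1 : ℝ) : ℂ) by push_cast; rfl, Complex.norm_cpow_real]
      calc _ = |p| * ‖w‖ * ‖1 + (s : ℂ) * w‖ ^ (p - 1) := by ring
        _ ≤ _ := by gcongr)
  simpa using h

theorem norm_one_add_ofReal_mul_le {s : ℝ} (hs : s ∈ Icc (0 : ℝ) 1) {w : ℂ} (hw : 0 ≤ w.re) :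
    ‖1 + (s : ℂ) * w‖ ≤ ‖1 + w‖ := by
  have h1 : s * w.re ≤ w.re := mul_le_of_le_one_left hw hs.2
  have h2 : 0 ≤ s * w.re := mul_nonneg hs.1 hw
  have h3 : s ^ 2 ≤ 1 := pow_le_one₀ hs.1 hs.2
  refine (sq_le_sq₀ (norm_nonneg _) (norm_nonneg _)).mp ?_
  rw [← Complex.normSq_eq_norm_sq, ← Complex.normSq_eq_norm_sq, Complex.normSq_apply,
    Complex.normSq_apply]
  simp only [Complex.add_re, Complex.one_re, Complex.re_ofReal_mul, Complex.add_im, Complex.one_im,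
    Complex.im_ofReal_mul, zero_add]
  nlinarith [mul_le_mul_of_nonneg_right h3 (sq_nonneg w.im)]

theorem one_le_norm_one_add_ofReal_mul {s : ℝ} (hs : s ∈ Icc (0 : ℝ) 1) {w : ℂ} (hw : 0 ≤ w.re) :
    1 ≤ ‖1 + (s : ℂ) * w‖ := by
  refine le_trans ?_ (Complex.re_le_norm _)
  rw [Complex.add_re, Complex.one_re, Complex.re_ofReal_mul]
  linarith [mul_nonneg hs.1 hw]

/-- Follows from √(1+y²) ≤ √2 max(1, |y|). For q = λ - 2 it is the origin of the extra factor
2^(λ/2) when λ > 2. -/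
theorem norm_one_add_mul_I_rpow_le {q : ℝ} (hq : 0 ≤ q) (y : ℝ) :
    ‖1 + (y : ℂ) * Complex.I‖ ^ q ≤ 2 ^ (q / 2) * (1 + |y| ^ q) := by
  have h : ‖1 + (y : ℂ) * Complex.I‖ ≤ √2 * max 1 |y| := by
    refine (sq_le_sq₀ (norm_nonneg _) (by positivity)).mp ?_
    have h1 := Complex.normSq_add_mul_I 1 y
    rw [Complex.normSq_eq_norm_sq, Complex.ofReal_one] at h1
    rw [h1, mul_pow, sq_sqrt two_pos.le]
    have h2 : 1 ≤ max 1 |y| ^ 2 := one_le_pow₀ (le_max_left _ _)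
    have h3 : y ^ 2 ≤ max 1 |y| ^ 2 := by
      rw [← sq_abs]
      exact pow_le_pow_left₀ (abs_nonneg y) (le_max_right _ _) 2
    linarith
  have h2 : √2 ^ q = 2 ^ (q / 2) := by
    rw [sqrt_eq_rpow, ← rpow_mul two_pos.le]
    congr 1
    ring
  refine (rpow_le_rpow (norm_nonneg _) h hq).trans ?_
  rw [mul_rpow (sqrt_nonneg 2) (by positivity), h2]
  gcongr
  rcases max_choice 1 |y| with h3 | h3 <;> rw [h3]
  · rw [one_rpow]
    linarith [rpow_nonneg (abs_nonneg y) q]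
  · linarith

/-- With σ = sinh t / t ≥ 1 and y = cot θ tanh(t/2), the integrand is t^p e^{-μt}(1+w)^p for w =
σ(1+iy) - 1. Here Re w = σ - 1 ≥ 0, and |1 + sw| stays between 1 and σ|1+iy|. -/
theorem norm_gegenbauerIntegrand_sub_le {p μ θ t M : ℝ} (ht : 0 < t)
    (hM : ∀ x ∈ Icc 1 (sinh t / t * ‖1 + ((cot θ * tanh (t / 2) : ℝ) : ℂ) * Complex.I‖),
      x ^ (p - 1) ≤ M) :
    ‖gegenbauerIntegrand p μ θ t - ((t ^ p * exp (-(μ * t)) : ℝ) : ℂ)‖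
      ≤ |p| * (t ^ p * exp (-(μ * t))) *
        ((sinh t / t - 1) + sinh t / t * |cot θ * tanh (t / 2)|) * M := by
  have hsh := sinh_pos_iff.mpr ht
  set σ := sinh t / t with hσ
  set y := cot θ * tanh (t / 2) with hy
  have hσ1 : 1 ≤ σ := (one_le_div ht).mpr (le_sinh_of_nonneg ht.le)
  have hσ0 : 0 < σ := one_pos.trans_le hσ1
  set w : ℂ := σ * (1 + (y : ℂ) * Complex.I) - 1 with hw
  have hw1 : 1 + w = σ * (1 + (y : ℂ) * Complex.I) := by rw [hw]; ring
  have hw2 : w = ((σ - 1 : ℝ) : ℂ) + ((σ * y : ℝ) : ℂ) * Complex.I := by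
    rw [hw]; push_cast; ring
  have hwre : w.re = σ - 1 := by
    rw [hw2, Complex.add_re, Complex.ofReal_re, Complex.re_ofReal_mul, Complex.I_re, mul_zero,
      add_zero]
  have hwre0 : 0 ≤ w.re := by rw [hwre]; linarith
  have hwn : ‖w‖ ≤ (σ - 1) + σ * |y| := by
    rw [hw2]
    refine (norm_add_le _ _).trans ?_
    rw [norm_mul, Complex.norm_I, mul_one, Complex.norm_real, Complex.norm_real, norm_mul,
      Real.norm_of_nonneg (by linarith : 0 ≤ σ - 1), Real.norm_of_nonneg hσ0.le, Real.norm_eq_abs]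
  have hn1 : ‖1 + w‖ = σ * ‖1 + (y : ℂ) * Complex.I‖ := by
    rw [hw1, norm_mul, Complex.norm_real, Real.norm_of_nonneg hσ0.le]
  have hkey := norm_one_add_cpow_sub_one_le (p := p) (M := M) hwre0 fun s hs =>
    hM _ ⟨one_le_norm_one_add_ofReal_mul hs hwre0,
      hn1 ▸ norm_one_add_ofReal_mul_le hs hwre0⟩
  have hM0 : 0 ≤ M := by
    have := hM 1 ⟨le_rfl, hn1 ▸ by
      simpa using one_le_norm_one_add_ofReal_mul (s := 1) ⟨zero_le_one, le_rfl⟩ hwre0⟩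
    rw [one_rpow] at this
    linarith
  have e : gegenbauerIntegrand p μ θ t - ((t ^ p * exp (-(μ * t)) : ℝ) : ℂ)
      = ((t ^ p * exp (-(μ * t)) : ℝ) : ℂ) * ((1 + w) ^ (p : ℂ) - 1) := by
    rw [hw1, ofReal_mul_cpow hσ0 fun h => by
      have := one_le_norm_one_add_mul_I y
      rw [h, norm_zero] at this
      linarith, gegenbauerIntegrand, ← hy]
    have h1 : t ^ p * σ ^ p = sinh t ^ p := by
      rw [← mul_rpow ht.le hσ0.le, hσ, mul_div_cancel₀ _ ht.ne']
    rw [← h1]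
    simp only [Complex.ofReal_mul]
    ring
  rw [e, norm_mul, Complex.norm_real, Real.norm_of_nonneg (by positivity)]
  calc _ ≤ t ^ p * exp (-(μ * t)) * (|p| * ((σ - 1) + σ * |y|) * M) := by
        refine mul_le_mul_of_nonneg_left (hkey.trans ?_) (by positivity)
        gcongr
    _ = _ := by ring

/-! ### Bounds for the residual on (0, π) -/

open MeasureTheory in
theorem abs_gegenbauerResidual_le {lam ν θ B : ℝ} {G : ℝ → ℝ} (hlam : 0 < lam) (hν : 0 < ν)
    (hθ : θ ∈ Ioo 0 π) (hG : IntegrableOn G (Ioi 0))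
    (hle : ∀ t, 0 < t → ‖gegenbauerIntegrand (lam - 1) (ν + lam) θ t
      - ((t ^ (lam - 1) * exp (-((ν + lam) * t)) : ℝ) : ℂ)‖ ≤ G t)
    (hB : 2 ^ lam * Gamma (lam + 1 / 2) / (√π * Gamma lam) * ∫ t in Ioi 0, G t = B) :
    |gegenbauerResidual lam ν θ| ≤ B := by
  have hμ : 0 < ν + lam := by linarith
  have hp : -1 < lam - 1 := by linarith
  have hΓ := Gamma_pos_of_pos hlam
  have hΓ' := Gamma_pos_of_pos (show 0 < lam + 1 / 2 by linarith)
  have hπ := sqrt_pos.mpr pi_pos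
  have hW := integrableOn_gegenbauerIntegrand θ hp hμ (by linarith)
  have hE := integrableOn_rpow_mul_exp_neg hp hμ
  have hEC : IntegrableOn (fun t : ℝ => ((t ^ (lam - 1) * exp (-((ν + lam) * t)) : ℝ) : ℂ))
      (Ioi 0) := hE.ofReal
  set K := 2 ^ lam * Gamma (lam + 1 / 2) / (√π * Gamma lam) with hK
  have hK0 : 0 < K := by positivity
  set e := Complex.exp (((ν + lam) * θ - lam * π / 2 : ℝ) * Complex.I) with he
  have hen : ‖e‖ = 1 := Complex.norm_exp_ofReal_mul_I _
  have hlead : leadingCoeff lam ν * cos ((ν + lam) * θ - lam * π / 2)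
      = K * (e * ∫ t in Ioi 0, ((t ^ (lam - 1) * exp (-((ν + lam) * t)) : ℝ) : ℂ)).re := by
    rw [integral_complex_ofReal, integral_rpow_mul_exp_neg_mul_Ioi hlam hμ, Complex.re_mul_ofReal, he,
      Complex.exp_ofReal_mul_I_re, leadingCoeff, hK, one_div (ν + lam), inv_rpow hμ.le]
    have := (rpow_pos_of_pos hμ lam).ne'
    field_simp
  have hR : gegenbauerResidual lam ν θ = K * (e * ∫ t in Ioi 0,
      (gegenbauerIntegrand (lam - 1) (ν + lam) θ t
        - ((t ^ (lam - 1) * exp (-((ν + lam) * t)) : ℝ) : ℂ))).re := by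
    rw [gegenbauerResidual, hlead, sin_rpow_mul_rightGGF hlam hν hθ, integral_sub hW hEC, mul_sub,
      Complex.sub_re, mul_sub]
  rw [hR, abs_mul, abs_of_pos hK0, ← hB]
  refine mul_le_mul_of_nonneg_left ((Complex.abs_re_le_norm _).trans ?_) hK0.le
  rw [norm_mul, hen, one_mul]
  refine norm_integral_le_of_norm_le hG ?_
  filter_upwards [ae_restrict_mem measurableSet_Ioi] with t ht
  exact hle t ht

theorem integral_rpow_mul_exp_neg {q r : ℝ} (hq : -1 < q) (hr : 0 < r) :
    ∫ t in Ioi 0, t ^ q * exp (-(r * t)) = Gamma (q + 1) / r ^ (q + 1) := by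
  have := integral_rpow_mul_exp_neg_mul_Ioi (a := q + 1) (by linarith) hr
  rw [add_sub_cancel_right] at this
  rw [this, one_div, inv_rpow hr.le]
  field_simp

open MeasureTheory in
theorem integrableOn_gamma_pair {q r : ℝ} (c d : ℝ) (hq : -1 < q) (hr : 0 < r) :
    IntegrableOn (fun t => c * (t ^ q * exp (-(r * t))) + d * (t ^ (q + 1) * exp (-(r * t))))
      (Ioi 0) :=
  ((integrableOn_rpow_mul_exp_neg hq hr).const_mul c).add
    ((integrableOn_rpow_mul_exp_neg (by linarith) hr).const_mul d)

open MeasureTheory in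
theorem integral_gamma_pair {q r : ℝ} (c d : ℝ) (hq : -1 < q) (hr : 0 < r) :
    ∫ t in Ioi 0, (c * (t ^ q * exp (-(r * t))) + d * (t ^ (q + 1) * exp (-(r * t))))
      = Gamma (q + 1) / r ^ (q + 1) * (c + d * ((q + 1) / r)) := by
  rw [integral_add ((integrableOn_rpow_mul_exp_neg hq hr).const_mul c)
    ((integrableOn_rpow_mul_exp_neg (by linarith) hr).const_mul d), integral_const_mul,
    integral_const_mul, integral_rpow_mul_exp_neg hq hr,
    integral_rpow_mul_exp_neg (by linarith) hr, Gamma_add_one (by linarith : q + 1 ≠ 0),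
    rpow_add_one hr.ne' (q + 1)]
  have := (rpow_pos_of_pos hr (q + 1)).ne'
  field_simp

theorem abs_cot_mul_tanh_half_le (θ : ℝ) {t : ℝ} (ht : 0 ≤ t) :
    |cot θ * tanh (t / 2)| ≤ |cot θ| * (t / 2) := by
  have ht2 : 0 ≤ t / 2 := by linarith
  rw [abs_mul, abs_of_nonneg (tanh_nonneg_of_nonneg ht2)]
  exact mul_le_mul_of_nonneg_left (tanh_le_self ht2) (abs_nonneg _)

theorem exp_neg_mul_sinh_div_le_one {t : ℝ} (ht : 0 < t) : exp (-t) * (sinh t / t) ≤ 1 := by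
  rw [exp_neg, ← div_eq_inv_mul, div_le_one (exp_pos t), div_le_iff₀ ht, mul_comm]
  exact sinh_le_mul_exp t

/-- A single e^{-t} absorbs the growth of sinh; this lowers the decay rate by one in the final
bounds. -/
theorem exp_neg_mul_perturbation_le (θ : ℝ) {t : ℝ} (ht : 0 < t) :
    exp (-t) * ((sinh t / t - 1) + sinh t / t * |cot θ * tanh (t / 2)|)
      ≤ 2 / 3 * t ^ 2 + |cot θ| * t := by
  have h1 : exp (-t) * (sinh t / t - 1) ≤ 2 / 3 * t ^ 2 := by
    have h := sinh_sub_self_le ht.le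
    rw [exp_neg, ← div_eq_inv_mul, div_le_iff₀ (exp_pos t), div_sub_one ht.ne', div_le_iff₀ ht]
    linarith
  have h2 : exp (-t) * (sinh t / t) * |cot θ * tanh (t / 2)| ≤ |cot θ| * t := by
    refine (mul_le_of_le_one_left (abs_nonneg _) (exp_neg_mul_sinh_div_le_one ht)).trans
      ((abs_cot_mul_tanh_half_le θ ht.le).trans ?_)
    have := mul_nonneg (abs_nonneg (cot θ)) ht.le
    linarith
  linarith

open MeasureTheory in
theorem abs_gegenbauerResidual_le_small {lam ν θ : ℝ} (hlam : 0 < lam) (hν : 0 < ν) (h2 : lam ≤ 2)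
    (h1 : 1 < ν + lam) (hθ : θ ∈ Ioo 0 π) :
    |gegenbauerResidual lam ν θ| ≤ residualBoundSmall lam ν θ := by
  have hr : 0 < ν + lam - 1 := by linarith
  have hq : -1 < lam := by linarith
  refine abs_gegenbauerResidual_le (G := fun t => |lam - 1| *
    (|cot θ| * (t ^ lam * exp (-((ν + lam - 1) * t)))
      + 2 / 3 * (t ^ (lam + 1) * exp (-((ν + lam - 1) * t))))) hlam hν hθ
    ((integrableOn_gamma_pair _ _ hq hr).const_mul _) (fun t ht => ?_) ?_
  -- The exponent λ - 2 is nonpositive, so the power of a number at least 1 is at most 1.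
  · refine (norm_gegenbauerIntegrand_sub_le (M := 1) ht fun x hx =>
      rpow_le_one_of_one_le_of_nonpos hx.1 (by linarith)).trans ?_
    have he : exp (-((ν + lam) * t)) = exp (-((ν + lam - 1) * t)) * exp (-t) := by
      rw [← exp_add]; congr 1; ring
    have h3 := mul_le_mul_of_nonneg_left (exp_neg_mul_perturbation_le θ ht)
      (by positivity : 0 ≤ |lam - 1| * t ^ (lam - 1) * exp (-((ν + lam - 1) * t)))
    have e1 : t ^ lam = t ^ (lam - 1) * t := by
      rw [← rpow_add_one ht.ne', sub_add_cancel]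
    have e2 : t ^ (lam + 1) = t ^ (lam - 1) * t ^ 2 := by
      rw [rpow_add_one ht.ne', e1]; ring
    rw [he, e2, e1]
    linarith
  · rw [integral_const_mul, integral_gamma_pair _ _ hq hr, Gamma_add_one hlam.ne',
      residualBoundSmall]
    have := (Gamma_pos_of_pos hlam).ne'
    have := (rpow_pos_of_pos hr (lam + 1)).ne'
    have := (sqrt_pos.mpr pi_pos).ne'
    field_simp

open MeasureTheory in
theorem abs_gegenbauerResidual_le_large {lam ν θ : ℝ} (hν : 0 < ν) (h2 : 2 < lam)
    (h3 : lam - 3 < ν) (hθ : θ ∈ Ioo 0 π) :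
    |gegenbauerResidual lam ν θ| ≤ residualBoundLarge lam ν θ := by
  have hlam : 0 < lam := by linarith
  have hr : 0 < ν + 1 := by linarith
  have hr' : 0 < ν - lam + 3 := by linarith
  have hq1 : -1 < lam := by linarith
  have hq2 : -1 < 2 * lam - 2 := by linarith
  have hI1 := integrableOn_gamma_pair |cot θ| (2 / 3) hq1 hr
  have hI2 := (integrableOn_gamma_pair |cot θ| (2 / 3) hq2 hr').const_mul
    (2 ^ (2 - lam) * |cot θ| ^ (lam - 2))
  refine abs_gegenbauerResidual_le (G := fun t => (lam - 1) * 2 ^ (lam / 2) *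
    ((|cot θ| * (t ^ lam * exp (-((ν + 1) * t)))
      + 2 / 3 * (t ^ (lam + 1) * exp (-((ν + 1) * t))))
      + 2 ^ (2 - lam) * |cot θ| ^ (lam - 2) *
        (|cot θ| * (t ^ (2 * lam - 2) * exp (-((ν - lam + 3) * t)))
          + 2 / 3 * (t ^ (2 * lam - 2 + 1) * exp (-((ν - lam + 3) * t)))))) hlam hν hθ
    ((hI1.add hI2).const_mul _) (fun t ht => ?_) ?_
  · have hq : 0 ≤ lam - 2 := by linarith
    have hsh := sinh_pos_iff.mpr ht
    set y := cot θ * tanh (t / 2) with hy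
    have hσ : 0 < sinh t / t := by positivity
    refine (norm_gegenbauerIntegrand_sub_le
      (M := (sinh t / t) ^ (lam - 2) * (2 ^ (lam / 2) * (1 + |y| ^ (lam - 2)))) ht
      fun x hx => ?_).trans ?_
    · rw [show lam - 1 - 1 = lam - 2 by ring]
      refine (rpow_le_rpow (by linarith [hx.1]) hx.2 hq).trans ?_
      rw [mul_rpow hσ.le (norm_nonneg _)]
      gcongr
      refine (norm_one_add_mul_I_rpow_le hq y).trans ?_
      gcongr
      · norm_num
      · linarith
    have hyq : |y| ^ (lam - 2) ≤ 2 ^ (2 - lam) * |cot θ| ^ (lam - 2) * t ^ (lam - 2) := by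
      refine (rpow_le_rpow (abs_nonneg y) (abs_cot_mul_tanh_half_le θ ht.le) hq).trans_eq ?_
      rw [mul_rpow (abs_nonneg _) (by linarith), div_rpow ht.le two_pos.le,
        show 2 - lam = -(lam - 2) by ring, rpow_neg two_pos.le]
      field_simp
    -- One e^{-t} pays for the perturbation and λ - 2 of them for σ^(λ-2), leaving the rate ν + 1.
    have he : exp (-((ν + lam) * t))
        = exp (-((ν + 1) * t)) * exp (-t) * exp (-t) ^ (lam - 2) := by
      rw [← exp_mul, ← exp_add, ← exp_add]; congr 1; ring
    have hP := exp_neg_mul_perturbation_le θ ht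
    rw [← hy] at hP
    have hσq : exp (-t) ^ (lam - 2) * (sinh t / t) ^ (lam - 2) ≤ 1 := by
      rw [← mul_rpow (exp_pos _).le hσ.le]
      exact rpow_le_one (by positivity) (exp_neg_mul_sinh_div_le_one ht) hq
    -- The term with |cot θ|^(λ-2) is weakened to the slower rate ν - λ + 3 that the stated bound
    -- uses.
    have hexp : exp (-((ν + 1) * t)) ≤ exp (-((ν - lam + 3) * t)) := by
      rw [exp_le_exp]
      nlinarith
    have hσ1 : 0 ≤ sinh t / t - 1 := by
      rw [sub_nonneg, one_le_div ht]; exact le_sinh_of_nonneg ht.le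
    have e0 : t ^ lam = t ^ (lam - 1) * t := by
      rw [← rpow_add_one ht.ne', sub_add_cancel]
    have e1 : t ^ (lam + 1) = t ^ (lam - 1) * t ^ 2 := by
      rw [rpow_add_one ht.ne', e0]; ring
    have e2 : t ^ (2 * lam - 2) = t ^ (lam - 1) * t * t ^ (lam - 2) := by
      rw [← rpow_add_one ht.ne', ← rpow_add ht]; congr 1; ring
    have e3 : t ^ (2 * lam - 2 + 1) = t ^ (lam - 1) * t ^ 2 * t ^ (lam - 2) := by
      rw [rpow_add_one ht.ne', e2]; ring
    have hp : 0 < lam - 1 := by linarith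
    rw [abs_of_pos hp, he, e0, e1, e2, e3]
    set D := 2 / 3 * t ^ 2 + |cot θ| * t with hD
    set A := (lam - 1) * 2 ^ (lam / 2) * t ^ (lam - 1) with hA
    have hA0 : 0 ≤ A := by positivity
    have hD0 : 0 ≤ D := by positivity
    set Z := 2 ^ (2 - lam) * |cot θ| ^ (lam - 2) * t ^ (lam - 2) with hZ
    have hZ0 : 0 ≤ Z := by positivity
    calc _ = A * exp (-((ν + 1) * t)) * ((exp (-t) ^ (lam - 2) * (sinh t / t) ^ (lam - 2))
          * (exp (-t) * (sinh t / t - 1 + sinh t / t * |y|)) * (1 + |y| ^ (lam - 2))) := by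
          rw [hA]; ring
      _ ≤ A * exp (-((ν + 1) * t)) * (1 * D * (1 + Z)) := by gcongr
      _ = A * exp (-((ν + 1) * t)) * D + A * exp (-((ν + 1) * t)) * D * Z := by ring
      _ ≤ A * exp (-((ν + 1) * t)) * D + A * exp (-((ν - lam + 3) * t)) * D * Z := by gcongr
      _ = _ := by rw [hA, hD, hZ]; ring
  · rw [integral_const_mul, integral_add hI1 hI2, integral_const_mul,
      integral_gamma_pair _ _ hq1 hr, integral_gamma_pair _ _ hq2 hr', Gamma_add_one hlam.ne',
      show 2 * lam - 2 + 1 = 2 * lam - 1 by ring, residualBoundLarge, Gamma_add_one hlam.ne',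
      show 3 * lam / 2 = lam + lam / 2 by ring, rpow_add two_pos]
    have := (Gamma_pos_of_pos hlam).ne'
    have := (rpow_pos_of_pos hr (lam + 1)).ne'
    have := (rpow_pos_of_pos hr' (2 * lam - 1)).ne'
    have := (sqrt_pos.mpr pi_pos).ne'
    field_simp

/-! ### Limits at π and continuous extension to [0, π] -/

theorem continuousAt_rightGGF_cos {lam : ℝ} (ν : ℝ) (hlam : 0 < lam) {θ : ℝ}
    (hθ : θ ∈ Ioo (-π) π) : ContinuousAt (fun θ => rightGGF lam ν (cos θ)) θ := by
  simp only [rightGGF, one_sub_cos_div_two]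
  have h1 := (hasDerivAt_hypergeometric (show 0 < lam + 1 / 2 by linarith) (-ν) (ν + 2 * lam)
    (abs_sin_sq_half_lt_one hθ)).continuousAt
  have h2 : ContinuousAt (fun θ : ℝ => sin (θ / 2) ^ 2) θ := by fun_prop
  exact ContinuousAt.comp (f := fun θ : ℝ => sin (θ / 2) ^ 2) h1 h2

theorem inv_Gamma_neg {ν : ℝ} (hν : 0 < ν) :
    (Gamma (-ν))⁻¹ = -(sin (ν * π) / π) * Gamma (ν + 1) := by
  have h := Gamma_mul_Gamma_one_sub (-ν)
  rw [sub_neg_eq_add, add_comm 1 ν, mul_neg, sin_neg, mul_comm π] at h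
  have hΓ := (Gamma_pos_of_pos (show 0 < ν + 1 by linarith)).ne'
  rw [← eq_div_iff hΓ] at h
  rw [h, div_neg, neg_div, inv_neg, inv_div, div_div_eq_mul_div]
  ring

-- With x = sin²(θ/2), sin θ = 2 sin(θ/2) cos(θ/2) turns (sin θ)^q into (2 sin(θ/2))^q (1 -
-- x)^(q/2), and x tends to 1 from below.
open Filter Topology in
theorem tendsto_sin_rpow_mul_rightGGF {lam ν q L : ℝ} (hq : 0 ≤ q)
    (hL : Tendsto (fun x : ℝ => (1 - x) ^ (q / 2) * ₂F₁ (-ν) (ν + 2 * lam) (lam + 1 / 2) x)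
      (𝓝[<] 1) (𝓝 L)) :
    Tendsto (fun θ => sin θ ^ q * rightGGF lam ν (cos θ)) (𝓝[<] π) (𝓝 (2 ^ q * L)) := by
  have hmem : ∀ᶠ θ : ℝ in 𝓝[<] π, θ ∈ Ioo 0 π := Ioo_mem_nhdsLT pi_pos
  have h1 : Tendsto (fun θ : ℝ => sin (θ / 2) ^ 2) (𝓝[<] π) (𝓝[<] 1) := by
    refine tendsto_nhdsWithin_iff.mpr ⟨?_, ?_⟩
    · have : Continuous fun θ : ℝ => sin (θ / 2) ^ 2 := by fun_prop
      have := this.tendsto π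
      rw [sin_pi_div_two, one_pow] at this
      exact this.mono_left nhdsWithin_le_nhds
    · filter_upwards [hmem] with θ hθ
      exact (abs_lt.mp (abs_sin_sq_half_lt_one ⟨by linarith [hθ.1, pi_pos], hθ.2⟩)).2
  have h2 : Tendsto (fun θ : ℝ => (2 * sin (θ / 2)) ^ q) (𝓝[<] π) (𝓝 (2 ^ q)) := by
    have : Continuous fun θ : ℝ => (2 * sin (θ / 2)) ^ q :=
      (by fun_prop : Continuous fun θ : ℝ => 2 * sin (θ / 2)).rpow_const fun _ => Or.inr hq
    have := this.tendsto π
    rw [sin_pi_div_two, mul_one] at this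
    exact this.mono_left nhdsWithin_le_nhds
  refine (h2.mul (hL.comp h1)).congr' ?_
  filter_upwards [hmem] with θ hθ
  have hθ' : θ ∈ Ioo (-π) π := ⟨by linarith [hθ.1, pi_pos], hθ.2⟩
  have hs : 0 < sin (θ / 2) :=
    sin_pos_of_pos_of_lt_pi (by linarith [hθ.1]) (by linarith [hθ.2, pi_pos])
  have hsin : sin θ = 2 * sin (θ / 2) * cos (θ / 2) := by
    rw [← sin_two_mul]; congr 1; ring
  rw [Function.comp_apply, one_sub_sin_sq_half_rpow hθ', rightGGF, one_sub_cos_div_two, hsin,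
    mul_rpow (by positivity) (cos_half_pos hθ').le, mul_div_cancel₀ q two_ne_zero]
  ring

-- The singular exponent is λ - 1/2, and λ < 2 says exactly that it is below (λ+1)/2.
open Filter Topology in
theorem tendsto_sin_rpow_mul_rightGGF_zero {lam : ℝ} (ν : ℝ) (hlam : 0 < lam) (h2 : lam < 2) :
    Tendsto (fun θ => sin θ ^ (lam + 1) * rightGGF lam ν (cos θ)) (𝓝[<] π) (𝓝 0) := by
  have := tendsto_sin_rpow_mul_rightGGF (ν := ν) (by linarith : 0 ≤ lam + 1)
    (tendsto_one_sub_rpow_mul_hypergeometric_zero (a := -ν) (b := ν + 2 * lam)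
      (c := lam + 1 / 2) (s := (lam + 1) / 2) (by linarith) (by linarith) (by linarith))
  rwa [mul_zero] at this

open Filter Topology in
theorem tendsto_sin_rpow_mul_rightGGF_singular {lam ν : ℝ} (hlam : 1 / 2 < lam) (hν : 0 < ν) :
    Tendsto (fun θ => sin θ ^ (2 * lam - 1) * rightGGF lam ν (cos θ)) (𝓝[<] π)
      (𝓝 (2 ^ (2 * lam - 1) * singularLimit lam ν)) := by
  have h := tendsto_hypergeometric_singular (a := -ν) (b := ν + 2 * lam) (c := lam + 1 / 2)
    (by linarith) (by linarith)
  rw [show -ν + (ν + 2 * lam) - (lam + 1 / 2) = (2 * lam - 1) / 2 by ring] at h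
  have := tendsto_sin_rpow_mul_rightGGF (by linarith : 0 ≤ 2 * lam - 1) h
  convert this using 3
  rw [inv_Gamma_neg hν, singularLimit, show (2 * lam - 1) / 2 = lam - 1 / 2 by ring]
  ring

theorem continuous_sin_rpow {q : ℝ} (hq : 0 ≤ q) : Continuous fun θ => sin θ ^ q :=
  continuous_sin.rpow_const fun _ => Or.inr hq

open Filter Topology in
theorem continuousOn_update_pi {f : ℝ → ℝ} {V : ℝ} (hf : ∀ θ ∈ Ico 0 π, ContinuousAt f θ)
    (hV : Tendsto f (𝓝[<] π) (𝓝 V)) : ContinuousOn (Function.update f π V) (Icc 0 π) := by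
  rw [continuousOn_update_iff, Icc_sdiff_right]
  exact ⟨fun θ hθ => (hf θ hθ).continuousWithinAt,
    fun _ => hV.mono_left (nhdsWithin_mono _ fun θ hθ => hθ.2)⟩

theorem abs_le_on_Icc_of_Ioo {f g : ℝ → ℝ} (hf : ContinuousOn f (Icc 0 π))
    (hg : ContinuousOn g (Icc 0 π)) (h : ∀ θ ∈ Ioo 0 π, |f θ| ≤ g θ) :
    ∀ θ ∈ Icc 0 π, |f θ| ≤ g θ := by
  intro θ hθ
  refine ContinuousWithinAt.closure_le (s := Ioo 0 π) ?_
    ((hf.abs θ hθ).mono Ioo_subset_Icc_self) ((hg θ hθ).mono Ioo_subset_Icc_self) h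
  rwa [closure_Ioo pi_pos.ne]

/-- Extension to `[0, π]` of the residual weighted by a power of the sine. -/
theorem exists_continuous_weighted_residual {lam ν k V : ℝ} {St S : ℝ → ℝ} (hlam : 0 < lam)
    (hk : 0 < k) (hV : Filter.Tendsto (fun θ => sin θ ^ (lam + k) * rightGGF lam ν (cos θ))
      (nhdsWithin π (Iio π)) (nhds V))
    (hSt : ContinuousOn St (Icc 0 π)) (hS : ∀ θ ∈ Ioo 0 π, St θ = sin θ ^ k * S θ)
    (hle : ∀ θ ∈ Ioo 0 π, |gegenbauerResidual lam ν θ| ≤ S θ) :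
    ∃ Rt : ℝ → ℝ, ContinuousOn Rt (Icc 0 π) ∧
      (∀ θ ∈ Ioo 0 π, Rt θ = sin θ ^ k * gegenbauerResidual lam ν θ) ∧
      (∀ θ ∈ Ico 0 π, Rt θ = sin θ ^ (lam + k) * rightGGF lam ν (cos θ)
        - leadingCoeff lam ν * sin θ ^ k * cos ((ν + lam) * θ - lam * π / 2)) ∧
      Rt 0 = 0 ∧ Rt π = V ∧ (∀ θ ∈ Icc 0 π, |Rt θ| ≤ St θ) := by
  set g : ℝ → ℝ := fun θ =>
    leadingCoeff lam ν * sin θ ^ k * cos ((ν + lam) * θ - lam * π / 2) with hg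
  set f : ℝ → ℝ := fun θ => sin θ ^ (lam + k) * rightGGF lam ν (cos θ) - g θ with hf
  have hgc : Continuous g :=
    (continuous_const.mul (continuous_sin_rpow hk.le)).mul (by fun_prop)
  have hgπ : g π = 0 := by simp [hg, zero_rpow hk.ne']
  have hfc : ∀ θ ∈ Ico 0 π, ContinuousAt f θ := fun θ hθ =>
    ((continuous_sin_rpow (by linarith)).continuousAt.mul (continuousAt_rightGGF_cos ν hlam
      ⟨by linarith [hθ.1, pi_pos], hθ.2⟩)).sub hgc.continuousAt
  have hfV : Filter.Tendsto f (nhdsWithin π (Iio π)) (nhds V) := by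
    have := hV.sub ((hgc.tendsto π).mono_left (nhdsWithin_le_nhds (s := Iio π)))
    rwa [hgπ, sub_zero] at this
  have hupd : ∀ θ ∈ Ico 0 π, Function.update f π V θ = f θ := fun θ hθ =>
    Function.update_of_ne hθ.2.ne _ _
  have hR : ∀ θ ∈ Ioo 0 π, Function.update f π V θ = sin θ ^ k * gegenbauerResidual lam ν θ := by
    intro θ hθ
    rw [hupd θ ⟨hθ.1.le, hθ.2⟩]
    simp only [hf, hg, gegenbauerResidual]
    rw [rpow_add (sin_pos_of_pos_of_lt_pi hθ.1 hθ.2)]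
    ring
  have hc := continuousOn_update_pi hfc hfV
  refine ⟨Function.update f π V, hc, hR, hupd, ?_, Function.update_self _ _ _,
    abs_le_on_Icc_of_Ioo hc hSt fun θ hθ => ?_⟩
  · rw [hupd 0 ⟨le_rfl, pi_pos⟩]
    simp [hf, hg, zero_rpow hk.ne', zero_rpow (by linarith : lam + k ≠ 0)]
  · have hs : 0 ≤ sin θ ^ k := rpow_nonneg (sin_pos_of_pos_of_lt_pi hθ.1 hθ.2).le _
    rw [hR θ hθ, hS θ hθ, abs_mul, abs_of_nonneg hs]
    exact mul_le_mul_of_nonneg_left (hle θ hθ) hs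

theorem exists_continuous_residualBoundSmall (lam ν : ℝ) :
    ∃ St : ℝ → ℝ, Continuous St ∧
      ∀ θ ∈ Ioo 0 π, St θ = sin θ * residualBoundSmall lam ν θ := by
  refine ⟨fun θ => lam * |lam - 1| * 2 ^ lam * Gamma (lam + 1 / 2) /
    (√π * (ν + lam - 1) ^ (lam + 1)) *
      (|cos θ| + 2 / 3 * ((lam + 1) / (ν + lam - 1)) * sin θ), by fun_prop, fun θ hθ => ?_⟩
  have hs := sin_pos_of_pos_of_lt_pi hθ.1 hθ.2
  have : |cos θ| = sin θ * |cot θ| := by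
    rw [cot_eq_cos_div_sin, abs_div, abs_of_pos hs, mul_div_cancel₀ _ hs.ne']
  simp only [residualBoundSmall, this]
  ring

/-- The most singular term has |cot θ|^(λ-1); the weight (sin θ)^(λ-1) turns it into a power of |cos
θ|. -/
theorem exists_continuous_residualBoundLarge {lam : ℝ} (hlam : 2 < lam) (ν : ℝ) :
    ∃ St : ℝ → ℝ, Continuous St ∧
      ∀ θ ∈ Ioo 0 π, St θ = sin θ ^ (lam - 1) * residualBoundLarge lam ν θ := by
  refine ⟨fun θ => lam * (lam - 1) * 2 ^ (3 * lam / 2) * Gamma (lam + 1 / 2) /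
    (√π * (ν + 1) ^ (lam + 1)) *
      (sin θ ^ (lam - 2) * |cos θ| + 2 / 3 * ((lam + 1) / (ν + 1)) * (sin θ ^ (lam - 2) * sin θ)
        + 2 ^ (2 - lam) * Gamma (2 * lam - 1) / Gamma (lam + 1) *
          ((ν + 1) ^ (lam + 1) / (ν - lam + 3) ^ (2 * lam - 1)) * |cos θ| ^ (lam - 2) *
          (|cos θ| + 2 / 3 * ((2 * lam - 1) / (ν - lam + 3)) * sin θ)), ?_, fun θ hθ => ?_⟩
  · have h1 := continuous_sin_rpow (show 0 ≤ lam - 2 by linarith)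
    have h2 : Continuous fun θ => |cos θ| ^ (lam - 2) :=
      continuous_cos.abs.rpow_const fun _ => Or.inr (by linarith)
    fun_prop
  have hs := sin_pos_of_pos_of_lt_pi hθ.1 hθ.2
  have hc : |cos θ| = sin θ * |cot θ| := by
    rw [cot_eq_cos_div_sin, abs_div, abs_of_pos hs, mul_div_cancel₀ _ hs.ne']
  simp only [residualBoundLarge, hc]
  rw [mul_rpow hs.le (abs_nonneg _), show lam - 1 = lam - 2 + 1 by ring, rpow_add_one hs.ne']
  ring

theorem mainTheorem3 (lam ν : ℝ) (hlam : 0 < lam) (hν : 0 < ν) :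
    (lam ≤ 2 → 1 < ν + lam →
      ∃ Rt St : ℝ → ℝ,
        ContinuousOn Rt (Icc 0 π) ∧ ContinuousOn St (Icc 0 π) ∧
        (∀ θ ∈ Ioo 0 π, Rt θ = sin θ * gegenbauerResidual lam ν θ) ∧
        (∀ θ ∈ Ico 0 π, Rt θ = sin θ ^ (lam + 1) * rightGGF lam ν (cos θ)
          - leadingCoeff lam ν * sin θ * cos ((ν + lam) * θ - lam * π / 2)) ∧
        (∀ θ ∈ Ioo 0 π, St θ = sin θ * residualBoundSmall lam ν θ) ∧
        Rt 0 = 0 ∧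
        (lam < 2 → Rt π = 0) ∧
        (lam = 2 → Rt π = 2 ^ (2 * lam - 1) * singularLimit lam ν) ∧
        (∀ θ ∈ Icc 0 π, |Rt θ| ≤ St θ)) ∧
    (2 < lam → lam - 3 < ν →
      ∃ Rt St : ℝ → ℝ,
        ContinuousOn Rt (Icc 0 π) ∧ ContinuousOn St (Icc 0 π) ∧
        (∀ θ ∈ Ioo 0 π, Rt θ = sin θ ^ (lam - 1) * gegenbauerResidual lam ν θ) ∧
        (∀ θ ∈ Ico 0 π, Rt θ = sin θ ^ (2 * lam - 1) * rightGGF lam ν (cos θ)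
          - leadingCoeff lam ν * sin θ ^ (lam - 1) * cos ((ν + lam) * θ - lam * π / 2)) ∧
        (∀ θ ∈ Ioo 0 π, St θ = sin θ ^ (lam - 1) * residualBoundLarge lam ν θ) ∧
        Rt 0 = 0 ∧
        Rt π = 2 ^ (2 * lam - 1) * singularLimit lam ν ∧
        (∀ θ ∈ Icc 0 π, |Rt θ| ≤ St θ)) := by
  refine ⟨fun h2 h1 => ?_, fun h2 h3 => ?_⟩
  · obtain ⟨St, hStc, hSt⟩ := exists_continuous_residualBoundSmall lam ν
    have hV : Filter.Tendsto (fun θ => sin θ ^ (lam + 1) * rightGGF lam ν (cos θ))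
        (nhdsWithin π (Iio π))
        (nhds (if lam < 2 then 0 else 2 ^ (2 * lam - 1) * singularLimit lam ν)) := by
      split_ifs with h
      · exact tendsto_sin_rpow_mul_rightGGF_zero ν hlam h
      -- Only λ = 2 remains, where the weight exponent λ + 1 equals the critical 2λ - 1.
      · have := tendsto_sin_rpow_mul_rightGGF_singular (lam := lam) (by linarith) hν
        rwa [show lam + 1 = 2 * lam - 1 by linarith]
    obtain ⟨Rt, hRtc, hR, hR', hR0, hRπ, hle⟩ := exists_continuous_weighted_residual
      (S := residualBoundSmall lam ν) hlam one_pos hV hStc.continuousOn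
      (by simpa only [rpow_one] using hSt)
      fun θ hθ => abs_gegenbauerResidual_le_small hlam hν h2 h1 hθ
    simp only [rpow_one] at hR hR'
    exact ⟨Rt, St, hRtc, hStc.continuousOn, hR, hR', hSt, hR0,
      fun h => by rw [hRπ, if_pos h], fun h => by rw [hRπ, if_neg h.not_lt], hle⟩
  · obtain ⟨St, hStc, hSt⟩ := exists_continuous_residualBoundLarge h2 ν
    have hV := tendsto_sin_rpow_mul_rightGGF_singular (lam := lam) (by linarith) hν
    have hk : 2 * lam - 1 = lam + (lam - 1) := by ring
    obtain ⟨Rt, hRtc, hR, hR', hR0, hRπ, hle⟩ := exists_continuous_weighted_residual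
      (S := residualBoundLarge lam ν) (k := lam - 1) hlam (by linarith) (hk ▸ hV)
      hStc.continuousOn hSt
      fun θ hθ => abs_gegenbauerResidual_le_large hν h2 h3 hθ
    rw [← hk] at hR'
    exact ⟨Rt, St, hRtc, hStc.continuousOn, hR, hR', hSt, hR0, by rw [hRπ, hk], hle⟩
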